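/- Let $(\mathcal X,\mathfrak S)$ be a measurable space with a filtration of $\sigma$-algebras $\mathfrak S_n\subset\mathfrak S_{n+1}\subset\mathfrak S$, $n\in\mathbb Z$, that is atomic: for each $n$ there is a countable family $\mathcal L_n\subset\mathfrak S_n$ of pairwise disjoint nonempty sets (atoms of generation $n$) such that every set in $\mathfrak S_n$ is a union of members of $\mathcal L_n$. Let $\mu,\nu$ be measures on $\mathfrak S$ that are finite on every atom. For an atom $I$ put $\mathbb E_I^\mu f=\langle f\rangle_{I,\mu}\mathbf 1_I$, where $\langle f\rangle_{I,\mu}=\mu(I)^{-1}\int_I f\,d\mu$, and $\langle f\rangle_{I,\mu}=0$ if $\mu(I)=0$; similarly for $\nu$. For $I\in\mathcal L_n$ the children of $(I,n)$ are the atoms $I'\in\mathcal L_{n+1}$ with $I'\subset I$. A symbol $b$ is a family of real- or complex-valued functions $\Delta^\nu_{(I,n)}b$, $n\in\mathbb Z$, $I\in\mathcal L_n$, such that $\Delta^\nu_{(I,n)}b$ is supported on $I$, $\nu$-integrable, constant on each child of $(I,n)$, and satisfies $\int_I\Delta^\nu_{(I,n)}b\,d\nu=0$. In particular, every function $b$ that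 is $\nu$-integrable on each atom is a symbol, with $\Delta^\nu_{(I,n)}b=\sum_{I'}\mathbb E_{I'}^\nu b-\mathbb E_I^\nu b$, the sum being over the children $I'$ of $(I,n)$. Assume that $\Delta^\nu_{(I,n)}b=0$ $\nu$-a.e. whenever $\mu(I)=0$ (this holds automatically if every atom with $\mu(I)=0$ has $\nu(I)=0$). The paraproduct is $$\pi f=\pi_b^{\mu,\nu}f=\sum_{n\in\mathbb Z}\ \sum_{I\in\mathcal L_n}\bigl(\mathbb E_I^\mu f\bigr)\bigl(\Delta^\nu_{(I,n)}b\bigr).$$ **Theorem.** Let $1<p\le 2$. There are constants $c(p),C(p)\in(0,\infty)$ depending only on $p$ such that, for all data as above, the following two conditions are equivalent: 1. there is $A\in[0,\infty)$ such that for every $f\in L^p(\mu)$ the series over $n\in\mathbb Z$ defining $\pi f$ converges in $L^p(\nu)$ (as a two-sided limit of the sums over $-M\le n<N$, $M,N\to\infty$) and $$\|\pi_b^{\mu,\nu}f\|_{L^p(\nu)}^p\le A^p\|f\|_{L^p(\mu)}^p ;$$ 2. there is $B\in[0,\infty)$ such that for every $k\in\mathbb Z$ and every $J\in\mathcal L_k$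 the series $s_J=\sum_{n\ge k}\sum_{I\in\mathcal L_n,\,I\subset J}\Delta^\nu_{(I,n)}b$ converges in $L^1(J,\nu)$ (this is automatic if $b$ is a function that is $\nu$-integrable on $J$) and $$\int_J\Bigl|\sum_{n\ge k}\ \sum_{I\in\mathcal L_n,\,I\subset J}\Delta^\nu_{(I,n)}b\Bigr|^p d\nu\le B^p\mu(J).$$ Moreover, the best (that is, infimal) constants $A,B\in[0,\infty]$ in these conditions satisfy $c(p)B\le A\le C(p)B$. -/

import Mathlib

open MeasureTheory Filter Topology
open scoped ENNReal NNReal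

/-- A filtration `𝓕 n`, `n ∈ ℤ`, of atomic sub-σ-algebras: for every `n` there is a countable
family `atoms n` of pairwise disjoint nonempty sets of `𝓕 n` such that every set of `𝓕 n` is a
union of members of `atoms n`. An atom may belong to several (even infinitely many) generations. -/
structure AtomicFiltration (X : Type*) [m0 : MeasurableSpace X] where
  /-- the filtration -/
  𝓕 : Filtration ℤ m0
  /-- the atoms of generation `n` -/
  atoms : ℤ → Set (Set X)
  countable_atoms : ∀ n, (atoms n).Countable
  nonempty_of_mem : ∀ n, ∀ I ∈ atoms n, I.Nonempty
  pairwiseDisjoint_atoms : ∀ n, (atoms n).PairwiseDisjoint id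
  measurableSet_of_mem : ∀ n, ∀ I ∈ atoms n, MeasurableSet[𝓕 n] I
  exists_eq_sUnion : ∀ n, ∀ A : Set X, MeasurableSet[𝓕 n] A → ∃ 𝒜 ⊆ atoms n, A = ⋃₀ 𝒜

namespace AtomicFiltration

variable {X : Type*} [m0 : MeasurableSpace X] {𝕜 : Type*} [RCLike 𝕜]

/-- The measure is finite on every atom. -/
def LocallyFinite (L : AtomicFiltration X) (μ : Measure X) : Prop :=
  ∀ n, ∀ I ∈ L.atoms n, μ I < ∞

/-- The atom of generation `n` that contains the point `x`. -/
def atom (L : AtomicFiltration X) (n : ℤ) (x : X) : Set X :=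
  ⋃₀ {I ∈ L.atoms n | x ∈ I}

/-- The averaging operator of generation `n`, the sum of `𝔼_I^μ f = ⟨f⟩_{I,μ} 1_I` over all atoms
`I` of generation `n`. The average over an atom of measure zero is zero. -/
noncomputable def expect (L : AtomicFiltration X) (μ : Measure X) (n : ℤ) (f : X → 𝕜) (x : X) : 𝕜 :=
  ⨍ y in L.atom n x, f y ∂μ

/-- The martingale differences of a function `b`. On an atom `I` of generation `n` this is
`Δ_{(I,n)}^ν b`, the sum of `𝔼_{I'}^ν b` over the children `I'` of `I`, minus `𝔼_I^ν b`. -/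
noncomputable def martDiff (L : AtomicFiltration X) (ν : Measure X) (b : X → 𝕜) (n : ℤ) (x : X) :
    𝕜 :=
  L.expect ν (n + 1) b x - L.expect ν n b x

/-- `d` is a collection of martingale differences with respect to `ν`. The member of the collection
that belongs to an atom `I` of generation `n` is the restriction of `d n` to `I`: it is integrable,
it is constant on the children of `I`, and its integral is zero. -/
structure IsMartingaleDifference (L : AtomicFiltration X) (ν : Measure X) (d : ℤ → X → 𝕜) :
    Prop where
  integrableOn : ∀ n, ∀ I ∈ L.atoms n, IntegrableOn (d n) I ν
  const_on_children : ∀ n, ∀ I ∈ L.atoms (n + 1), ∀ x ∈ I, ∀ y ∈ I, d n x = d n y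
  integral_eq_zero : ∀ n, ∀ I ∈ L.atoms n, ∫ x in I, d n x ∂ν = 0

/-- The partial sum over the generations `-M ≤ n < N` of the two-weight paraproduct
`π f = ∑_{n ∈ ℤ} ∑_{I ∈ atoms n} (𝔼_I^μ f) (Δ_{(I,n)}^ν b)`,
where `d` is the collection of the martingale differences of the symbol `b`. -/
noncomputable def paraPartial (L : AtomicFiltration X) (μ : Measure X) (d : ℤ → X → 𝕜) (f : X → 𝕜)
    (M N : ℕ) (x : X) : 𝕜 :=
  ∑ n ∈ Finset.Ico (-(M : ℤ)) (N : ℤ), L.expect μ n f x * d n x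

/-- `g` is the paraproduct `π f`: `g ∈ L^p(ν)`, and the two-sided series that defines `π f`
converges to `g` in `L^p(ν)`. -/
def IsParaproduct (L : AtomicFiltration X) (μ ν : Measure X) (d : ℤ → X → 𝕜) (p : ℝ)
    (f g : X → 𝕜) : Prop :=
  MemLp g (ENNReal.ofReal p) ν ∧
    Tendsto (fun MN : ℕ × ℕ ↦
      eLpNorm (L.paraPartial μ d f MN.1 MN.2 - g) (ENNReal.ofReal p) ν) atTop (𝓝 0)

/-- The paraproduct is bounded from `L^p(μ)` to `L^p(ν)` with constant `A`. -/
def ParaBounded (L : AtomicFiltration X) (μ ν : Measure X) (d : ℤ → X → 𝕜) (p : ℝ) (A : ℝ≥0) :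
    Prop :=
  ∀ f : X → 𝕜, MemLp f (ENNReal.ofReal p) μ →
    ∃ g : X → 𝕜, L.IsParaproduct μ ν d p f g ∧
      eLpNorm g (ENNReal.ofReal p) ν ≤ A * eLpNorm f (ENNReal.ofReal p) μ

/-- `s` is the sum of the martingale differences `Δ_{(I,n)}^ν b` over all atoms `I ⊆ J`, `n ≥ k`,
where `J` is an atom of generation `k`; the series over the generations converges in `L^1(J, ν)`.
On `J`, the differences with `I ⊆ J` of generation `n ≥ k` add up to `d n`. (If `b` is a function
that is integrable on `J`, then this convergence holds by the martingale convergence theorem.) -/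
def IsLocalSum (ν : Measure X) (d : ℤ → X → 𝕜) (k : ℤ) (J : Set X) (s : X → 𝕜) : Prop :=
  AEStronglyMeasurable s (ν.restrict J) ∧
    Tendsto (fun N : ℤ ↦ eLpNorm ((∑ n ∈ Finset.Ico k N, d n) - s) 1 (ν.restrict J)) atTop (𝓝 0)

/-- The testing condition with constant `B`:
`∫_J |∑_{I ⊆ J} Δ_I^ν b|^p dν ≤ B^p μ(J)` for all atoms `J`. -/
def Testing (L : AtomicFiltration X) (μ ν : Measure X) (d : ℤ → X → 𝕜) (p : ℝ) (B : ℝ≥0) : Prop :=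
  ∀ k, ∀ J ∈ L.atoms k, ∃ s : X → 𝕜, IsLocalSum ν d k J s ∧
    ∫⁻ x in J, ‖s x‖ₑ ^ p ∂ν ≤ (B : ℝ≥0∞) ^ p * μ J

/-- The best constant in the estimate of the paraproduct (`∞` if there is none). -/
noncomputable def paraConst (L : AtomicFiltration X) (μ ν : Measure X) (d : ℤ → X → 𝕜) (p : ℝ) :
    ℝ≥0∞ :=
  ⨅ (A : ℝ≥0) (_ : L.ParaBounded μ ν d p A), (A : ℝ≥0∞)

/-- The best constant in the testing condition (`∞` if there is none). -/
noncomputable def testConst (L : AtomicFiltration X) (μ ν : Measure X) (d : ℤ → X → 𝕜) (p : ℝ) :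
    ℝ≥0∞ :=
  ⨅ (B : ℝ≥0) (_ : L.Testing μ ν d p B), (B : ℝ≥0∞)

theorem atom_eq (L : AtomicFiltration X) {n : ℤ} {I : Set X} (hI : I ∈ L.atoms n) {x : X}
    (hx : x ∈ I) : L.atom n x = I := by
  have : {I' ∈ L.atoms n | x ∈ I'} = {I} := by
    ext I'
    constructor
    · rintro ⟨h1, h2⟩
      by_contra hne
      exact Set.disjoint_left.1 (L.pairwiseDisjoint_atoms n h1 hI hne) h2 hx
    · rintro rfl
      exact ⟨hI, hx⟩
  rw [atom, this, Set.sUnion_singleton]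

theorem expect_eq (L : AtomicFiltration X) (μ : Measure X) {n : ℤ} {I : Set X}
    (hI : I ∈ L.atoms n) {x : X} (hx : x ∈ I) (f : X → 𝕜) :
    L.expect μ n f x = ⨍ y in I, f y ∂μ := by
  rw [expect, L.atom_eq hI hx]

/-- The martingale differences of a locally integrable function are a collection of martingale
differences, so functions are admissible symbols. -/
theorem isMartingaleDifference_martDiff (L : AtomicFiltration X) (ν : Measure X)
    (hν : L.LocallyFinite ν) (b : X → 𝕜) (hb : ∀ n, ∀ I ∈ L.atoms n, IntegrableOn b I ν) :
    L.IsMartingaleDifference ν (L.martDiff ν b) := by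
  have hmeas : ∀ n, ∀ I ∈ L.atoms n, MeasurableSet I := fun n I hI ↦
    L.𝓕.le n _ (L.measurableSet_of_mem n I hI)
  have hE : ∀ n, ∀ I ∈ L.atoms n, IntegrableOn (L.expect ν n b) I ν ∧
      (∫ x in I, L.expect ν n b x ∂ν = ∫ x in I, b x ∂ν) ∧
      ∫ x in I, ‖L.expect ν n b x‖ ∂ν ≤ ∫ x in I, ‖b x‖ ∂ν := by
    intro n I hI
    have hfin := hν n I hI
    have heq : Set.EqOn (L.expect ν n b) (fun _ ↦ ⨍ y in I, b y ∂ν) I :=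
      fun x hx ↦ L.expect_eq ν hI hx b
    have hz : ∫ x in I, L.expect ν n b x ∂ν = ∫ x in I, b x ∂ν := by
      rw [setIntegral_congr_fun (hmeas n I hI) heq, setIntegral_const]
      exact measure_smul_setAverage b hfin.ne
    refine ⟨(integrableOn_congr_fun heq (hmeas n I hI)).2 (integrableOn_const hfin.ne), hz, ?_⟩
    have h1 : ∫ x in I, ‖L.expect ν n b x‖ ∂ν = ‖∫ x in I, b x ∂ν‖ := by
      rw [← hz, setIntegral_congr_fun (hmeas n I hI) heq,
        setIntegral_congr_fun (g := fun _ ↦ ‖⨍ y in I, b y ∂ν‖) (hmeas n I hI)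
          (fun x hx ↦ by simp only [heq hx]), setIntegral_const, setIntegral_const, norm_smul,
        Real.norm_of_nonneg measureReal_nonneg, smul_eq_mul]
    rw [h1]
    exact norm_integral_le_integral_norm _
  have hE' : ∀ n, ∀ I ∈ L.atoms n, IntegrableOn (L.expect ν (n + 1) b) I ν ∧
      ∫ x in I, L.expect ν (n + 1) b x ∂ν = ∫ x in I, b x ∂ν := by
    intro n I hI
    obtain ⟨𝒜, h𝒜, hIU⟩ := L.exists_eq_sUnion (n + 1) I
      (L.𝓕.mono (by lia) _ (L.measurableSet_of_mem n I hI))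
    have : Countable 𝒜 := ((L.countable_atoms (n + 1)).mono h𝒜).to_subtype
    have hI' : I = ⋃ i : 𝒜, (i : Set X) := by rw [hIU, Set.sUnion_eq_iUnion]
    have hm : ∀ i : 𝒜, MeasurableSet (i : Set X) := fun i ↦ hmeas (n + 1) i (h𝒜 i.2)
    have hd : Pairwise (Function.onFun Disjoint fun i : 𝒜 ↦ (i : Set X)) := fun i j hij ↦
      L.pairwiseDisjoint_atoms (n + 1) (h𝒜 i.2) (h𝒜 j.2) (fun h ↦ hij (Subtype.ext h))
    have hbI := hb n I hI
    rw [hI'] at hbI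
    have hs := hasSum_integral_iUnion hm hd hbI.norm
    have hi : IntegrableOn (L.expect ν (n + 1) b) (⋃ i : 𝒜, (i : Set X)) ν :=
      integrableOn_iUnion_of_summable_integral_norm (fun i ↦ (hE _ _ (h𝒜 i.2)).1)
        (hs.summable.of_nonneg_of_le (fun i ↦ integral_nonneg fun _ ↦ norm_nonneg _)
          fun i ↦ (hE _ _ (h𝒜 i.2)).2.2)
    rw [hI']
    refine ⟨hi, ?_⟩
    rw [integral_iUnion hm hd hi, integral_iUnion hm hd hbI]
    exact tsum_congr fun i ↦ (hE _ _ (h𝒜 i.2)).2.1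
  refine ⟨fun n I hI ↦ (hE' n I hI).1.sub (hE n I hI).1, ?_, ?_⟩
  · intro n I hI x hx y hy
    obtain ⟨𝒜, h𝒜, hU⟩ := L.exists_eq_sUnion n Set.univ MeasurableSet.univ
    obtain ⟨P, hP, hxP⟩ : x ∈ ⋃₀ 𝒜 := hU ▸ Set.mem_univ x
    have hPm := L.𝓕.mono (show n ≤ n + 1 by lia) _ (L.measurableSet_of_mem n P (h𝒜 hP))
    obtain ⟨ℬ, hℬ, hPU⟩ := L.exists_eq_sUnion (n + 1) P hPm
    have hyP : y ∈ P := by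
      rw [hPU] at hxP ⊢
      obtain ⟨Q, hQ, hxQ⟩ := hxP
      have : Q = I := by rw [← L.atom_eq (hℬ hQ) hxQ, L.atom_eq hI hx]
      exact ⟨Q, hQ, this ▸ hy⟩
    simp only [martDiff, L.expect_eq ν hI hx, L.expect_eq ν hI hy, L.expect_eq ν (h𝒜 hP) hxP,
      L.expect_eq ν (h𝒜 hP) hyP]
  · intro n I hI
    simp only [martDiff]
    rw [integral_sub (hE' n I hI).1 (hE n I hI).1, (hE' n I hI).2, (hE n I hI).2.1, sub_self]

end AtomicFiltration

/-! Testing implies boundedness. The terms `e n = L.expect μ n f * d n` are again martingale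
differences for ν, because the factor `L.expect μ n f` is constant on the atoms of generation n. For
1 < p ≤ 2 a martingale is controlled in L^p(ν) by its square function
(`IsMartingaleDifference.lintegral_rpow_le`), so it suffices to bound the integral of (∑ |E_n f|² |d
n|²)^(p/2).

Replace |E_n f| by a running maximum R_n of the averages of |f| and sum by parts: ∑ R_j² |d_j|² =
∑_m (R_m² - R_{m-1}²) ∑_{j ≥ m} |d_j|². Since p/2 ≤ 1, the power goes inside the sum over m. Each
weight is constant on the atoms J of generation m, and over J the tail square function is that of
the local sum s_J. It is bounded by ∫_J |s_J|^p (`IsMartingaleDifference.lintegral_square_rpow_le`),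
hence by B^p μ(J) up to a constant. This trades ν for μ (`Adapted.lintegral_mul_le`); the weights
telescope to R^p, and Doob's inequality for μ (`lintegral_maxExpect_rpow_le`) closes the estimate.

For the telescoping, (R_m² - R_{m-1}²)^(p/2) must be dominated by R_m^p - R_{m-1}^p. For p < 2 this
fails for small increments of an ordinary running maximum. `lazyMax` moves only when it more than
doubles, so at each jump both quantities are comparable to R_m^p, while the averages stay below
twice the maximum.

The martingale inequalities all follow one scheme: a pointwise inequality for one step, modulo a
term Re(a * d n) with a known at generation n, which integrates to zero on every atom
(`IsMartingaleDifference.lintegral_le`).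

Boundedness implies testing. Apply the paraproduct to the indicator of J. On J the generations
before k add a constant and the later ones add exactly d n, so s_J is the paraproduct minus its mean
over J; removing the mean costs a factor 2. -/

namespace AtomicFiltration

/-! ### Atoms, adapted functions, and integration atom by atom. -/

section Atoms

variable {X : Type*} [MeasurableSpace X] (L : AtomicFiltration X)

theorem measurableSet_atom {n : ℤ} {I : Set X} (hI : I ∈ L.atoms n) : MeasurableSet I :=
  L.𝓕.le n _ (L.measurableSet_of_mem n I hI)

theorem exists_mem_atoms (n : ℤ) (x : X) : ∃ I ∈ L.atoms n, x ∈ I := by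
  obtain ⟨𝒜, h𝒜, hU⟩ := L.exists_eq_sUnion n Set.univ MeasurableSet.univ
  obtain ⟨P, hP, hxP⟩ : x ∈ ⋃₀ 𝒜 := hU ▸ Set.mem_univ x
  exact ⟨P, h𝒜 hP, hxP⟩

theorem subset_of_mem_atoms {m n : ℤ} (hmn : m ≤ n) {I J : Set X} (hI : I ∈ L.atoms n)
    (hJ : J ∈ L.atoms m) {x : X} (hxI : x ∈ I) (hxJ : x ∈ J) : I ⊆ J := by
  obtain ⟨ℬ, hℬ, hPU⟩ := L.exists_eq_sUnion n J (L.𝓕.mono hmn _ (L.measurableSet_of_mem m J hJ))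
  obtain ⟨Q, hQ, hxQ⟩ : x ∈ ⋃₀ ℬ := hPU ▸ hxJ
  have : Q = I := by rw [← L.atom_eq (hℬ hQ) hxQ, L.atom_eq hI hxI]
  rw [hPU, ← this]
  exact Set.subset_sUnion_of_mem hQ

/-- A function is adapted to generation `n` if it is constant on the atoms of generation `n`. -/
def Adapted {β : Type*} (n : ℤ) (f : X → β) : Prop :=
  ∀ I ∈ L.atoms n, ∀ x ∈ I, ∀ y ∈ I, f x = f y

variable {L}

theorem Adapted.mono {β : Type*} {m n : ℤ} (hmn : m ≤ n) {f : X → β} (hf : L.Adapted m f) :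
    L.Adapted n f := by
  intro I hI x hx y hy
  obtain ⟨J, hJ, hxJ⟩ := L.exists_mem_atoms m x
  exact hf J hJ x hxJ y (L.subset_of_mem_atoms hmn hI hJ hx hxJ hy)

/-- The preimage of any set at all is a countable union of atoms. Hence compositions with arbitrary
functions, such as negative powers or case distinctions, need no separate measurability argument. -/
theorem Adapted.measurable {β : Type*} [MeasurableSpace β] {n : ℤ} {f : X → β}
    (hf : L.Adapted n f) : Measurable f := by
  intro S _
  have : f ⁻¹' S = ⋃₀ {I ∈ L.atoms n | ∃ x ∈ I, f x ∈ S} := by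
    ext x
    constructor
    · intro hx
      obtain ⟨I, hI, hxI⟩ := L.exists_mem_atoms n x
      exact ⟨I, ⟨hI, x, hxI, hx⟩, hxI⟩
    · rintro ⟨I, ⟨hI, y, hyI, hy⟩, hxI⟩
      change f x ∈ S
      rwa [hf I hI x hxI y hyI]
  rw [this]
  exact MeasurableSet.sUnion ((L.countable_atoms n).mono fun _ h ↦ h.1)
    fun I hI ↦ L.measurableSet_atom hI.1

theorem Adapted.comp {β γ : Type*} {n : ℤ} {f : X → β} (hf : L.Adapted n f) (g : β → γ) :
    L.Adapted n fun x ↦ g (f x) :=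
  fun I hI x hx y hy ↦ congrArg g (hf I hI x hx y hy)

theorem Adapted.comp₂ {β γ δ : Type*} {n : ℤ} {f : X → β} {g : X → γ} (hf : L.Adapted n f)
    (hg : L.Adapted n g) (F : β → γ → δ) : L.Adapted n fun x ↦ F (f x) (g x) :=
  fun I hI x hx y hy ↦ congrArg₂ F (hf I hI x hx y hy) (hg I hI x hx y hy)

theorem Adapted.sum {ι β : Type*} [AddCommMonoid β] {n : ℤ} {s : Finset ι} {f : ι → X → β}
    (hf : ∀ i ∈ s, L.Adapted n (f i)) : L.Adapted n fun x ↦ ∑ i ∈ s, f i x :=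
  fun I hI x hx y hy ↦ Finset.sum_congr rfl fun i hi ↦ hf i hi I hI x hx y hy

variable (L)

theorem adapted_expect {𝕜 : Type*} [RCLike 𝕜] (μ : Measure X) (n : ℤ) (f : X → 𝕜) :
    L.Adapted n (L.expect μ n f) := by
  intro I hI x hx y hy
  rw [L.expect_eq μ hI hx, L.expect_eq μ hI hy]

theorem lintegral_eq_tsum_atoms (ν : Measure X) (n : ℤ) (f : X → ℝ≥0∞) :
    ∫⁻ x, f x ∂ν = ∑' I : L.atoms n, ∫⁻ x in (I : Set X), f x ∂ν := by
  have : Countable (L.atoms n) := (L.countable_atoms n).to_subtype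
  rw [← lintegral_iUnion (s := fun I : L.atoms n ↦ (I : Set X)) (fun I ↦ L.measurableSet_atom I.2)
    (fun i j hij ↦ L.pairwiseDisjoint_atoms n i.2 j.2 fun h ↦ hij (Subtype.ext h))]
  have : (⋃ I : L.atoms n, (I : Set X)) = Set.univ := by
    refine Set.eq_univ_of_forall fun x ↦ ?_
    obtain ⟨I, hI, hx⟩ := L.exists_mem_atoms n x
    exact Set.mem_iUnion.2 ⟨⟨I, hI⟩, hx⟩
  rw [this, Measure.restrict_univ]

theorem lintegral_mono_of_atoms {μ ν : Measure X} {n : ℤ} {u v : X → ℝ≥0∞}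
    (h : ∀ I ∈ L.atoms n, ∫⁻ x in I, u x ∂μ ≤ ∫⁻ x in I, v x ∂ν) :
    ∫⁻ x, u x ∂μ ≤ ∫⁻ x, v x ∂ν := by
  rw [L.lintegral_eq_tsum_atoms μ n, L.lintegral_eq_tsum_atoms ν n]
  exact ENNReal.tsum_le_tsum fun I ↦ h I I.2

theorem ae_of_atoms {ν : Measure X} {n : ℤ} {P : X → Prop}
    (h : ∀ I ∈ L.atoms n, ∀ᵐ x ∂ν.restrict I, P x) : ∀ᵐ x ∂ν, P x := by
  have hc : Countable (L.atoms n) := (L.countable_atoms n).to_subtype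
  have : (⋃ I : L.atoms n, (I : Set X)) = Set.univ := by
    refine Set.eq_univ_of_forall fun x ↦ ?_
    obtain ⟨I, hI, hx⟩ := L.exists_mem_atoms n x
    exact Set.mem_iUnion.2 ⟨⟨I, hI⟩, hx⟩
  rw [← Measure.restrict_univ (μ := ν), ← this, ae_restrict_iUnion_iff]
  exact fun I ↦ h I I.2

/-- A pointwise inequality modulo a function whose mean over each atom vanishes can be
integrated. -/
theorem lintegral_le_of_le_add {ν : Measure X} {n : ℤ} {u v l : X → ℝ} (hv : Measurable v)
    (hu0 : ∀ x, 0 ≤ u x) (hv0 : ∀ x, 0 ≤ v x) (hl : ∀ I ∈ L.atoms n, IntegrableOn l I ν)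
    (hl0 : ∀ I ∈ L.atoms n, ∫ x in I, l x ∂ν = 0) (h : ∀ᵐ x ∂ν, u x ≤ v x + l x) :
    ∫⁻ x, ENNReal.ofReal (u x) ∂ν ≤ ∫⁻ x, ENNReal.ofReal (v x) ∂ν := by
  refine L.lintegral_mono_of_atoms (n := n) fun I hI ↦ ?_
  -- Once the right side is finite on `I`, `v` is integrable there, and the Bochner integral can be
  -- used to drop `l`. No global integrability is needed.
  by_cases hfin : ∫⁻ x in I, ENNReal.ofReal (v x) ∂ν = ∞
  · rw [hfin]; exact le_top
  have hvi : IntegrableOn v I ν := by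
    refine ⟨hv.aestronglyMeasurable, ?_⟩
    rw [hasFiniteIntegral_iff_ofReal (Eventually.of_forall hv0)]
    exact lt_top_iff_ne_top.2 hfin
  have h' := ae_restrict_of_ae (s := I) h
  calc ∫⁻ x in I, ENNReal.ofReal (u x) ∂ν
      ≤ ∫⁻ x in I, ENNReal.ofReal (v x + l x) ∂ν :=
        lintegral_mono_ae (h'.mono fun x hx ↦ ENNReal.ofReal_le_ofReal hx)
    _ = ENNReal.ofReal (∫ x in I, (v x + l x) ∂ν) :=
        (ofReal_integral_eq_lintegral_ofReal (hvi.add (hl I hI))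
          (h'.mono fun x hx ↦ (hu0 x).trans hx)).symm
    _ = ENNReal.ofReal (∫ x in I, v x ∂ν) := by
        rw [integral_add hvi (hl I hI), hl0 I hI, add_zero]
    _ = ∫⁻ x in I, ENNReal.ofReal (v x) ∂ν :=
        ofReal_integral_eq_lintegral_ofReal hvi (Eventually.of_forall hv0)

end Atoms

/-! ### Martingale differences and their transforms by adapted factors. -/

section MartingaleDifference

variable {X : Type*} [MeasurableSpace X] {𝕜 : Type*} [RCLike 𝕜] {L : AtomicFiltration X}
  {ν : Measure X} {d : ℤ → X → 𝕜}

theorem IsMartingaleDifference.adapted (hd : L.IsMartingaleDifference ν d) (n : ℤ) :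
    L.Adapted (n + 1) (d n) :=
  hd.const_on_children n

theorem IsMartingaleDifference.integrableOn_mul (hd : L.IsMartingaleDifference ν d) {n : ℤ}
    {a : X → 𝕜} (ha : L.Adapted n a) {I : Set X} (hI : I ∈ L.atoms n) :
    IntegrableOn (fun x ↦ a x * d n x) I ν := by
  obtain ⟨y, hy⟩ := L.nonempty_of_mem n I hI
  refine (integrableOn_congr_fun (fun x hx ↦ ?_) (L.measurableSet_atom hI)).1
    ((hd.integrableOn n I hI).const_mul (a y))
  change a y * d n x = a x * d n x
  rw [ha I hI x hx y hy]

theorem IsMartingaleDifference.integral_mul (hd : L.IsMartingaleDifference ν d) {n : ℤ}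
    {a : X → 𝕜} (ha : L.Adapted n a) {I : Set X} (hI : I ∈ L.atoms n) :
    ∫ x in I, a x * d n x ∂ν = 0 := by
  obtain ⟨y, hy⟩ := L.nonempty_of_mem n I hI
  rw [setIntegral_congr_fun (g := fun x ↦ a y * d n x) (L.measurableSet_atom hI)
    fun x hx ↦ by simp only [ha I hI x hx y hy], integral_const_mul, hd.integral_eq_zero n I hI,
    mul_zero]

theorem IsMartingaleDifference.mul (hd : L.IsMartingaleDifference ν d) {a : ℤ → X → 𝕜}
    (ha : ∀ n, L.Adapted n (a n)) : L.IsMartingaleDifference ν fun n x ↦ a n x * d n x where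
  integrableOn n _ hI := hd.integrableOn_mul (ha n) hI
  const_on_children n := (((ha n).mono (by lia)).comp₂ (hd.adapted n) (· * ·))
  integral_eq_zero n _ hI := hd.integral_mul (ha n) hI

/-- The integration step for martingales: a pointwise inequality modulo `Re (a * d n)`, where `a`
is constant on the atoms of generation `n`, can be integrated. -/
theorem IsMartingaleDifference.lintegral_le (hd : L.IsMartingaleDifference ν d) {n : ℤ}
    {a : X → 𝕜} (ha : L.Adapted n a) {u v : X → ℝ} (hv : Measurable v) (hu0 : ∀ x, 0 ≤ u x)
    (hv0 : ∀ x, 0 ≤ v x) (h : ∀ᵐ x ∂ν, u x ≤ v x + RCLike.re (a x * d n x)) :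
    ∫⁻ x, ENNReal.ofReal (u x) ∂ν ≤ ∫⁻ x, ENNReal.ofReal (v x) ∂ν := by
  refine L.lintegral_le_of_le_add (n := n) (l := fun x ↦ RCLike.re (a x * d n x)) hv hu0 hv0
    (fun I hI ↦ (hd.integrableOn_mul ha hI).re) (fun I hI ↦ ?_) h
  rw [integral_re (hd.integrableOn_mul ha hI), hd.integral_mul ha hI, map_zero]

end MartingaleDifference

end AtomicFiltration

/-! ### Scalar inequalities, and the bound of a martingale by its square function. -/

section Scalar

/-- A concave power lies below its tangent at `a`; this is Bernoulli's inequality rescaled. -/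
theorem Real.rpow_le_rpow_add_mul_sub {a b θ : ℝ} (ha : 0 < a) (hb : 0 ≤ b) (h0 : 0 ≤ θ)
    (h1 : θ ≤ 1) : b ^ θ ≤ a ^ θ + θ * a ^ (θ - 1) * (b - a) := by
  have h := _root_.rpow_one_add_le_one_add_mul_self (s := b / a - 1)
    (by have := div_nonneg hb ha.le; linarith) h0 h1
  rw [add_sub_cancel, Real.div_rpow hb ha.le, div_le_iff₀ (Real.rpow_pos_of_pos ha θ)] at h
  rw [Real.rpow_sub_one ha.ne']
  calc b ^ θ ≤ _ := h
    _ = _ := by field_simp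

theorem Real.rpow_add_mul_sub_le_rpow {a b p : ℝ} (ha : 0 < a) (hb : 0 ≤ b) (hp : 1 ≤ p) :
    a ^ p + p * a ^ (p - 1) * (b - a) ≤ b ^ p := by
  have h := one_add_mul_self_le_rpow_one_add (s := b / a - 1)
    (by have := div_nonneg hb ha.le; linarith) hp
  rw [add_sub_cancel, Real.div_rpow hb ha.le, le_div_iff₀ (Real.rpow_pos_of_pos ha p)] at h
  rw [Real.rpow_sub_one ha.ne']
  calc _ = _ := by field_simp
    _ ≤ _ := h

/-- Young's inequality, read off from the tangent at `R` of the convex function `x ^ p`. -/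
theorem Real.mul_mul_rpow_le_add {p x R : ℝ} (hp : 1 < p) (hx : 0 ≤ x) (hR : 0 ≤ R) :
    p * x * R ^ (p - 1) ≤ (p - 1) * R ^ p + x ^ p := by
  rcases hR.eq_or_lt with rfl | hR
  · rw [Real.zero_rpow (by linarith), Real.zero_rpow (by linarith)]
    have := Real.rpow_nonneg hx p
    linarith
  · have h := Real.rpow_add_mul_sub_le_rpow hR hx hp.le
    have : R ^ (p - 1) * R = R ^ p := by
      rw [Real.rpow_sub_one hR.ne', div_mul_cancel₀ _ hR.ne']
    nlinarith

/-- Young's inequality with `2 * x` in place of `x`. The coefficient 1/2 of `R ^ p` allows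
absorption in the proof of Doob's inequality. -/
theorem Real.mul_rpow_le_half_add {p x R : ℝ} (hp : 1 < p) (hx : 0 ≤ x) (hR : 0 ≤ R) :
    p / (p - 1) * (x * R ^ (p - 1)) ≤ R ^ p / 2 + 2 ^ p / (2 * (p - 1)) * x ^ p := by
  have h := Real.mul_mul_rpow_le_add hp (x := 2 * x) (by positivity) hR
  have hp' : 0 < p - 1 := by linarith
  rw [Real.mul_rpow zero_le_two hx] at h
  calc p / (p - 1) * (x * R ^ (p - 1)) = (p * (2 * x) * R ^ (p - 1)) / (2 * (p - 1)) := by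
        field_simp
    _ ≤ ((p - 1) * R ^ p + 2 ^ p * x ^ p) / (2 * (p - 1)) := by gcongr
    _ = _ := by field_simp

/-- The scalar inequality behind the bound of a martingale by its square function. -/
theorem Real.rpow_add_le_of_sq_le {θ w s t z : ℝ} (h0 : 1 / 2 ≤ θ) (h1 : θ ≤ 1) (hs : 0 ≤ s)
    (hsw : s ≤ w) (ht : 0 ≤ t) (hz : z ^ 2 ≤ 4 * w * t) (hn : 0 ≤ w + z + 2 * t) :
    (w + z + 2 * t) ^ θ + 28 * s ^ θ ≤
      w ^ θ + 28 * (s + t) ^ θ + θ * w ^ (θ - 1) * z := by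
  have hw : 0 ≤ w := hs.trans hsw
  have key : 0 < s + t → s ^ θ + θ * (s + t) ^ (θ - 1) * t ≤ (s + t) ^ θ := fun h ↦ by
    have := Real.rpow_le_rpow_add_mul_sub h hs (by linarith) h1
    linarith
  rcases lt_or_ge w t with hwt | hwt
  -- Large step. The new value is at most 5 t^θ and the linear term at least -2 t^θ, while (s + t)^θ
  -- - s^θ ≥ t^θ / 4 because s + t ≤ 2 t and θ ≥ 1/2. Hence the constant 28 = 4 * (5 + 2).
  · have ht0 : 0 < t := hw.trans_lt hwt
    have hst : 0 < s + t := by linarith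
    have e1 : (w + z + 2 * t) ^ θ ≤ 5 * t ^ θ := by
      have hz' : z ≤ w + t := by
        refine abs_le_of_sq_le_sq' ?_ (by positivity) |>.2
        nlinarith [sq_nonneg (w - t)]
      calc (w + z + 2 * t) ^ θ ≤ (5 * t) ^ θ := by
            apply Real.rpow_le_rpow hn (by linarith) (by linarith)
        _ = 5 ^ θ * t ^ θ := Real.mul_rpow (by norm_num) ht
        _ ≤ 5 ^ (1 : ℝ) * t ^ θ := by
            gcongr
            norm_num
        _ = _ := by rw [Real.rpow_one]
    have e2 : -(2 * t ^ θ) ≤ θ * w ^ (θ - 1) * z := by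
      rcases hw.eq_or_lt with rfl | hw
      -- The bound on `z ^ 2` forces `z = 0`, so the value of `0 ^ (θ - 1)` is immaterial.
      · have : z = 0 := by nlinarith
        rw [this, mul_zero]
        have := Real.rpow_nonneg ht θ
        linarith
      · have : |z| ≤ 2 * (w ^ (1 / 2 : ℝ) * t ^ (1 / 2 : ℝ)) := by
          apply abs_le_of_sq_le_sq _ (by positivity)
          rw [← Real.sqrt_eq_rpow, ← Real.sqrt_eq_rpow, mul_pow, mul_pow, Real.sq_sqrt hw.le,
            Real.sq_sqrt ht]
          linarith
        have e3 : w ^ (θ - 1) * |z| ≤ 2 * t ^ θ := by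
          calc w ^ (θ - 1) * |z| ≤ w ^ (θ - 1) * (2 * (w ^ (1 / 2 : ℝ) * t ^ (1 / 2 : ℝ))) := by
                gcongr
            _ = 2 * (w ^ (θ - 1 / 2) * t ^ (1 / 2 : ℝ)) := by
                have : w ^ (θ - 1 / 2) = w ^ (θ - 1) * w ^ (1 / 2 : ℝ) := by
                  rw [← Real.rpow_add hw]; congr 1; ring
                rw [this]; ring
            _ ≤ 2 * (t ^ (θ - 1 / 2) * t ^ (1 / 2 : ℝ)) := by
                gcongr
            _ = 2 * t ^ θ := by
                rw [← Real.rpow_add ht0]; congr 2; ring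
        have e4 := neg_abs_le z
        have e5 : 0 ≤ w ^ (θ - 1) * |z| := by positivity
        have e6 : 0 ≤ θ * w ^ (θ - 1) := by positivity
        nlinarith
    have e3 : t ^ θ ≤ 4 * (θ * (s + t) ^ (θ - 1) * t) := by
      have a1 : (2 * t) ^ (θ - 1) ≤ (s + t) ^ (θ - 1) :=
        Real.rpow_le_rpow_of_nonpos hst (by linarith) (by linarith)
      have a2 : (1 / 2 : ℝ) ≤ 2 ^ (θ - 1) := by
        calc (1 / 2 : ℝ) = 2 ^ (-1 : ℝ) := by rw [Real.rpow_neg_one]; norm_num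
          _ ≤ _ := Real.rpow_le_rpow_of_exponent_le (by norm_num) (by linarith)
      rw [Real.mul_rpow zero_le_two ht, Real.rpow_sub_one ht0.ne'] at a1
      have a3 : 0 < t ^ θ / t := by positivity
      have a4 : t ^ θ / t * t = t ^ θ := div_mul_cancel₀ _ ht0.ne'
      have a5 : 1 / 2 * (t ^ θ / t) ≤ (s + t) ^ (θ - 1) := by nlinarith
      have a6 : 1 / 2 * (1 / 2 * (t ^ θ / t)) ≤ θ * (s + t) ^ (θ - 1) := by gcongr
      nlinarith
    have e4 := key hst
    have e5 := Real.rpow_nonneg hw θ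
    nlinarith
  · rcases hw.eq_or_lt with rfl | hw
    · obtain rfl : s = 0 := le_antisymm hsw hs
      obtain rfl : t = 0 := le_antisymm hwt ht
      obtain rfl : z = 0 := by nlinarith
      simp
    -- Small step. The tangent at `w` leaves the error 2 θ w^(θ-1) t, and s + t ≤ 2 w makes w^(θ-1)
    -- comparable to (s + t)^(θ-1). This needs `s ≤ w`.
    · have e1 := Real.rpow_le_rpow_add_mul_sub hw hn (θ := θ) (by linarith) h1
      rcases (add_nonneg hs ht).eq_or_lt with h | hst
      · obtain rfl : t = 0 := by linarith
        rw [add_zero] at *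
        nlinarith
      · have a1 : (2 * w) ^ (θ - 1) ≤ (s + t) ^ (θ - 1) :=
          Real.rpow_le_rpow_of_nonpos hst (by linarith) (by linarith)
        have a2 : (1 / 2 : ℝ) ≤ 2 ^ (θ - 1) := by
          calc (1 / 2 : ℝ) = 2 ^ (-1 : ℝ) := by rw [Real.rpow_neg_one]; norm_num
            _ ≤ _ := Real.rpow_le_rpow_of_exponent_le (by norm_num) (by linarith)
        rw [Real.mul_rpow zero_le_two hw.le] at a1
        have a3 : 0 < w ^ (θ - 1) := by positivity
        have a4 : w ^ (θ - 1) ≤ 2 * (s + t) ^ (θ - 1) := by nlinarith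
        have a5 : θ * w ^ (θ - 1) * t ≤ θ * (2 * (s + t) ^ (θ - 1)) * t := by gcongr
        have a6 : 0 ≤ θ * (s + t) ^ (θ - 1) * t := by positivity
        have := key hst
        nlinarith

theorem RCLike.norm_add_sq' {𝕜 : Type*} [RCLike 𝕜] (y k : 𝕜) :
    ‖y + k‖ ^ 2 = ‖y‖ ^ 2 + 2 * RCLike.re (star y * k) + ‖k‖ ^ 2 := by
  rw [@norm_add_sq 𝕜 𝕜 _ _ _ y k, RCLike.inner_apply, mul_comm k]
  rfl

/-- One step of a martingale with value `y`, squared square function `s` and increment `k`. The last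
term is linear in `k` with a coefficient depending on the past only. Adding `s` to ‖y‖² tames the
singularity of the derivatives at `y = 0`. -/
theorem RCLike.rpow_norm_add_sq_le {𝕜 : Type*} [RCLike 𝕜] {p s : ℝ} (hp : 1 < p) (hp2 : p ≤ 2)
    (hs : 0 ≤ s) (y k : 𝕜) :
    (‖y + k‖ ^ 2 + (s + ‖k‖ ^ 2)) ^ (p / 2) + 28 * s ^ (p / 2) ≤
      (‖y‖ ^ 2 + s) ^ (p / 2) + 28 * (s + ‖k‖ ^ 2) ^ (p / 2) +
        RCLike.re ((p * (‖y‖ ^ 2 + s) ^ (p / 2 - 1) : ℝ) * star y * k) := by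
  have e := RCLike.norm_add_sq' y k
  have hz : (2 * RCLike.re (star y * k)) ^ 2 ≤ 4 * (‖y‖ ^ 2 + s) * ‖k‖ ^ 2 := by
    have h1 := RCLike.abs_re_le_norm (star y * k)
    rw [norm_mul, norm_star] at h1
    have h2 := sq_le_sq' (neg_le_of_abs_le h1) (le_of_abs_le h1)
    have : 0 ≤ s * ‖k‖ ^ 2 := by positivity
    nlinarith
  have h := Real.rpow_add_le_of_sq_le (θ := p / 2) (w := ‖y‖ ^ 2 + s) (s := s) (t := ‖k‖ ^ 2)
    (z := 2 * RCLike.re (star y * k)) (by linarith) (by linarith) hs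
    (by nlinarith [sq_nonneg ‖y‖]) (by positivity) hz (by nlinarith [sq_nonneg ‖y + k‖, sq_nonneg ‖k‖])
  rw [mul_assoc (RCLike.ofReal _), RCLike.re_ofReal_mul]
  have e2 : ‖y + k‖ ^ 2 + (s + ‖k‖ ^ 2) =
    ‖y‖ ^ 2 + s + 2 * RCLike.re (star y * k) + 2 * ‖k‖ ^ 2 := by rw [e]; ring
  rw [e2]
  calc _ ≤ _ := h
    _ = _ := by ring

end Scalar

namespace AtomicFiltration

variable {X : Type*} [MeasurableSpace X] {𝕜 : Type*} [RCLike 𝕜] {L : AtomicFiltration X}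
  {ν : Measure X} {d : ℤ → X → 𝕜}

theorem IsMartingaleDifference.adapted_sum (hd : L.IsMartingaleDifference ν d) (a : ℤ) (N : ℕ) :
    L.Adapted (a + N) fun x ↦ ∑ j ∈ Finset.range N, d (a + j) x :=
  Adapted.sum fun j hj ↦ (hd.adapted _).mono (by have := Finset.mem_range.1 hj; lia)

theorem IsMartingaleDifference.adapted_sum_sq (hd : L.IsMartingaleDifference ν d) (a : ℤ) (N : ℕ) :
    L.Adapted (a + N) fun x ↦ ∑ j ∈ Finset.range N, ‖d (a + j) x‖ ^ 2 :=
  Adapted.sum fun j hj ↦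
    ((hd.adapted _).mono (by have := Finset.mem_range.1 hj; lia)).comp (‖·‖ ^ 2)

/-- For `1 < p ≤ 2`, a martingale is bounded in `L^p` by its square function. -/
theorem IsMartingaleDifference.lintegral_rpow_le (hd : L.IsMartingaleDifference ν d) {p : ℝ}
    (hp : 1 < p) (hp2 : p ≤ 2) (a : ℤ) (N : ℕ) :
    ∫⁻ x, ENNReal.ofReal (‖∑ j ∈ Finset.range N, d (a + j) x‖ ^ p) ∂ν ≤
      28 * ∫⁻ x, ENNReal.ofReal ((∑ j ∈ Finset.range N, ‖d (a + j) x‖ ^ 2) ^ (p / 2)) ∂ν := by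
  set g : ℕ → X → 𝕜 := fun N x ↦ ∑ j ∈ Finset.range N, d (a + j) x with hg
  set s : ℕ → X → ℝ := fun N x ↦ ∑ j ∈ Finset.range N, ‖d (a + j) x‖ ^ 2 with hs
  have hs0 : ∀ N x, 0 ≤ s N x := fun N x ↦ Finset.sum_nonneg fun _ _ ↦ by positivity
  have hga : ∀ N : ℕ, L.Adapted (a + N) (g N) := hd.adapted_sum a
  have hsa : ∀ N : ℕ, L.Adapted (a + N) (s N) := hd.adapted_sum_sq a
  have hΦ : ∀ N : ℕ, L.Adapted (a + N) fun x ↦ (‖g N x‖ ^ 2 + s N x) ^ (p / 2) :=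
    fun N ↦ (hga N).comp₂ (hsa N) fun y s ↦ (‖y‖ ^ 2 + s) ^ (p / 2)
  have hΨ : ∀ N : ℕ, L.Adapted (a + N) fun x ↦ s N x ^ (p / 2) :=
    fun N ↦ (hsa N).comp (· ^ (p / 2))
  have main : ∀ N, ∫⁻ x, ENNReal.ofReal ((‖g N x‖ ^ 2 + s N x) ^ (p / 2)) ∂ν ≤
      28 * ∫⁻ x, ENNReal.ofReal (s N x ^ (p / 2)) ∂ν := by
    intro N
    induction N with
    | zero => simp [hg, hs, show p / 2 ≠ 0 by linarith]
    | succ N ih =>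
      have hmono : ∫⁻ x, ENNReal.ofReal (s N x ^ (p / 2)) ∂ν ≤
          ∫⁻ x, ENNReal.ofReal (s (N + 1) x ^ (p / 2)) ∂ν := by
        refine lintegral_mono fun x ↦ ENNReal.ofReal_le_ofReal ?_
        refine Real.rpow_le_rpow (hs0 N x) ?_ (by linarith)
        simp only [hs, Finset.sum_range_succ]
        nlinarith [sq_nonneg ‖d (a + N) x‖]
      by_cases hfin : ∫⁻ x, ENNReal.ofReal (s N x ^ (p / 2)) ∂ν = ∞
      · rw [hfin, top_le_iff] at hmono
        rw [hmono, ENNReal.mul_top (by norm_num)]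
        exact le_top
      have hstep := hd.lintegral_le (n := a + N)
        (a := fun x ↦ ((p * (‖g N x‖ ^ 2 + s N x) ^ (p / 2 - 1) : ℝ) : 𝕜) * star (g N x))
        ((hga N).comp₂ (hsa N) fun y s ↦ ((p * (‖y‖ ^ 2 + s) ^ (p / 2 - 1) : ℝ) : 𝕜) * star y)
        (u := fun x ↦ (‖g (N + 1) x‖ ^ 2 + s (N + 1) x) ^ (p / 2) + 28 * s N x ^ (p / 2))
        (v := fun x ↦ (‖g N x‖ ^ 2 + s N x) ^ (p / 2) + 28 * s (N + 1) x ^ (p / 2))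
        ((hΦ N).measurable.add ((hΨ (N + 1)).measurable.const_mul _))
        (fun x ↦ by have := hs0 N x; have := hs0 (N + 1) x; positivity)
        (fun x ↦ by have := hs0 N x; have := hs0 (N + 1) x; positivity)
        (Eventually.of_forall fun x ↦ by
          have := RCLike.rpow_norm_add_sq_le hp hp2 (hs0 N x) (g N x) (d (a + N) x)
          simpa only [hg, hs, Finset.sum_range_succ] using this)
      have hsplit : ∀ M K : ℕ, ∫⁻ x, ENNReal.ofReal ((‖g M x‖ ^ 2 + s M x) ^ (p / 2) +
          28 * s K x ^ (p / 2)) ∂ν = ∫⁻ x, ENNReal.ofReal ((‖g M x‖ ^ 2 + s M x) ^ (p / 2)) ∂ν +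
          28 * ∫⁻ x, ENNReal.ofReal (s K x ^ (p / 2)) ∂ν := by
        intro M K
        rw [← lintegral_const_mul _ (hΨ K).measurable.ennreal_ofReal,
          ← lintegral_add_left (hΦ M).measurable.ennreal_ofReal]
        refine lintegral_congr fun x ↦ ?_
        have := hs0 M x
        have := hs0 K x
        rw [ENNReal.ofReal_add (by positivity) (by positivity), ENNReal.ofReal_mul (by norm_num)]
        norm_num
      rw [hsplit, hsplit] at hstep
      -- Finiteness lets this term be cancelled from both sides of `hstep`.
      have hfin' : 28 * ∫⁻ x, ENNReal.ofReal (s N x ^ (p / 2)) ∂ν ≠ ∞ :=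
        ENNReal.mul_ne_top (by norm_num) hfin
      refine (ENNReal.add_le_add_iff_right hfin').1 (hstep.trans ?_)
      rw [add_comm]
      gcongr
  refine (lintegral_mono fun x ↦ ENNReal.ofReal_le_ofReal ?_).trans (main N)
  have : ‖g N x‖ ^ p = (‖g N x‖ ^ 2) ^ (p / 2) := by
    rw [← Real.rpow_natCast, ← Real.rpow_mul (norm_nonneg _)]
    congr 1
    push_cast
    ring
  change ‖g N x‖ ^ p ≤ _
  rw [this]
  exact Real.rpow_le_rpow (by positivity) (by linarith [hs0 N x]) (by linarith)

end AtomicFiltration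

/-! ### The lazy maximum and Doob's maximal inequality. -/

/-- A running maximum of a sequence that is updated only when the sequence more than doubles it. -/
noncomputable def lazyMax (x : ℕ → ℝ) : ℕ → ℝ
  | 0 => x 0
  | j + 1 => if 2 * lazyMax x j < x (j + 1) then x (j + 1) else lazyMax x j

section LazyMax

variable {x : ℕ → ℝ}

theorem lazyMax_succ_cases (j : ℕ) : lazyMax x (j + 1) = lazyMax x j ∨
    (lazyMax x (j + 1) = x (j + 1) ∧ 2 * lazyMax x j < lazyMax x (j + 1)) := by
  rw [lazyMax]
  split_ifs with h
  · exact Or.inr ⟨rfl, h⟩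
  · exact Or.inl rfl

theorem lazyMax_nonneg (hx : ∀ j, 0 ≤ x j) (j : ℕ) : 0 ≤ lazyMax x j := by
  induction j with
  | zero => exact hx 0
  | succ j ih =>
    rcases lazyMax_succ_cases (x := x) j with h | ⟨h, _⟩
    · rwa [h]
    · rw [h]; exact hx _

theorem lazyMax_le_succ (hx : ∀ j, 0 ≤ x j) (j : ℕ) : lazyMax x j ≤ lazyMax x (j + 1) := by
  have := lazyMax_nonneg hx j
  rcases lazyMax_succ_cases (x := x) j with h | ⟨_, h⟩ <;> linarith

theorem lazyMax_mono (hx : ∀ j, 0 ≤ x j) : Monotone (lazyMax x) :=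
  monotone_nat_of_le_succ (lazyMax_le_succ hx)

theorem le_two_mul_lazyMax (hx : ∀ j, 0 ≤ x j) (j : ℕ) : x j ≤ 2 * lazyMax x j := by
  cases j with
  | zero =>
    have := hx 0
    simp only [lazyMax]
    linarith
  | succ j =>
    have := hx (j + 1)
    rw [lazyMax]
    split_ifs with h <;> linarith

theorem lazyMax_succ_rpow_le (hx : ∀ j, 0 ≤ x j) {p : ℝ} (j : ℕ) :
    lazyMax x (j + 1) ^ p ≤ lazyMax x j ^ p + x (j + 1) ^ p := by
  have h1 := Real.rpow_nonneg (lazyMax_nonneg hx j) p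
  have h2 := Real.rpow_nonneg (hx (j + 1)) p
  rcases lazyMax_succ_cases (x := x) j with h | ⟨h, _⟩ <;> rw [h] <;> linarith

theorem two_mul_rpow_le_of_two_mul_lt {p R R' : ℝ} (hp : 1 ≤ p) (hR : 0 ≤ R) (h : 2 * R < R') :
    2 * R ^ p ≤ R' ^ p := by
  calc 2 * R ^ p = 2 ^ (1 : ℝ) * R ^ p := by rw [Real.rpow_one]
    _ ≤ 2 ^ p * R ^ p := by
        gcongr
        norm_num
    _ = (2 * R) ^ p := (Real.mul_rpow zero_le_two hR).symm
    _ ≤ R' ^ p := Real.rpow_le_rpow (by linarith) h.le (by linarith)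

/-- The scalar inequality behind Doob's maximal inequality. -/
theorem lazyMax_succ_add_le (hx : ∀ j, 0 ≤ x j) {p : ℝ} (hp : 1 < p) (j : ℕ) :
    lazyMax x (j + 1) ^ p + p / (p - 1) * (x j * lazyMax x j ^ (p - 1)) ≤
      lazyMax x j ^ p + p / (p - 1) * (x (j + 1) * lazyMax x (j + 1) ^ (p - 1)) +
        -(p / (p - 1) * lazyMax x j ^ (p - 1)) * (x (j + 1) - x j) := by
  rcases lazyMax_succ_cases (x := x) j with h | ⟨h, h2⟩
  · rw [h]
    apply le_of_eq
    ring
  · rw [h] at h2 ⊢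
    have hR := lazyMax_nonneg hx j
    set R := lazyMax x j
    have hx' : 0 < x (j + 1) := by linarith
    have e1 : x (j + 1) * x (j + 1) ^ (p - 1) = x (j + 1) ^ p := by
      rw [Real.rpow_sub_one hx'.ne', mul_div_cancel₀ _ hx'.ne']
    have hp' : 0 < p - 1 := by linarith
    -- At a jump the terms with `x j` cancel, and what remains is Young's inequality for `x (j + 1)`
    -- and `R`.
    have e2 : p / (p - 1) * (x (j + 1) * R ^ (p - 1)) ≤
        R ^ p + (p / (p - 1) - 1) * x (j + 1) ^ p := by
      have h := Real.mul_mul_rpow_le_add hp hx'.le hR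
      calc _ = (p * x (j + 1) * R ^ (p - 1)) / (p - 1) := by field_simp
        _ ≤ ((p - 1) * R ^ p + x (j + 1) ^ p) / (p - 1) := by gcongr
        _ = _ := by field_simp; ring
    rw [e1]
    linarith

end LazyMax

namespace AtomicFiltration

variable {X : Type*} [MeasurableSpace X] {𝕜 : Type*} [RCLike 𝕜] (L : AtomicFiltration X)

theorem norm_expect_le (μ : Measure X) (n : ℤ) (f : X → 𝕜) (x : X) :
    ‖L.expect μ n f x‖ ≤ L.expect μ n (fun y ↦ ‖f y‖) x :=
  norm_integral_le_integral_norm _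

theorem expect_nonneg {μ : Measure X} {n : ℤ} {h : X → ℝ} (hh : ∀ x, 0 ≤ h x) (x : X) :
    0 ≤ L.expect μ n h x :=
  integral_nonneg hh

/-- Jensen's inequality for averages over atoms. -/
theorem lintegral_expect_rpow_le {μ : Measure X} (hμ : L.LocallyFinite μ) {h : X → ℝ}
    (hh : ∀ x, 0 ≤ h x) (hi : ∀ n, ∀ I ∈ L.atoms n, IntegrableOn h I μ) {p : ℝ} (hp : 1 < p)
    (n : ℤ) :
    ∫⁻ x, ENNReal.ofReal (L.expect μ n h x ^ p) ∂μ ≤ ∫⁻ x, ENNReal.ofReal (h x ^ p) ∂μ := by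
  refine L.lintegral_mono_of_atoms (n := n) fun I hI ↦ ?_
  by_cases hfin : ∫⁻ x in I, ENNReal.ofReal (h x ^ p) ∂μ = ∞
  · rw [hfin]; exact le_top
  by_cases h0 : μ I = 0
  · rw [setLIntegral_measure_zero _ _ h0]; exact zero_le
  have hp0 : ∀ x, 0 ≤ h x ^ p := fun x ↦ Real.rpow_nonneg (hh x) p
  have hpi : IntegrableOn (fun x ↦ h x ^ p) I μ := by
    refine ⟨?_, ?_⟩
    · exact ((hi n I hI).1.aemeasurable.pow_const p).aestronglyMeasurable
    · rw [hasFiniteIntegral_iff_ofReal (Eventually.of_forall hp0)]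
      exact lt_top_iff_ne_top.2 hfin
  have hJ : (⨍ x in I, h x ∂μ) ^ p ≤ ⨍ x in I, h x ^ p ∂μ :=
    (convexOn_rpow hp.le).map_set_average_le
      ((Real.continuous_rpow_const (by linarith)).continuousOn) isClosed_Ici h0 (hμ n I hI).ne
      (Eventually.of_forall hh) (hi n I hI) hpi
  rw [setLIntegral_congr_fun (g := fun _ ↦ ENNReal.ofReal ((⨍ y in I, h y ∂μ) ^ p))
    (L.measurableSet_atom hI) fun x hx ↦ by rw [L.expect_eq μ hI hx], setLIntegral_const,
    ← ofReal_integral_eq_lintegral_ofReal hpi (Eventually.of_forall hp0)]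
  have hm := measure_smul_setAverage (fun x ↦ h x ^ p) (hμ n I hI).ne
  rw [← hm, smul_eq_mul, ENNReal.ofReal_mul measureReal_nonneg, measureReal_def,
    ENNReal.ofReal_toReal (hμ n I hI).ne, mul_comm]
  gcongr

/-- The lazy maximum of the averages of `h` over the atoms of the generations `a, …, a + j`. -/
noncomputable def maxExpect (μ : Measure X) (h : X → ℝ) (a : ℤ) (j : ℕ) (x : X) : ℝ :=
  lazyMax (fun i ↦ L.expect μ (a + i) h x) j

theorem adapted_maxExpect (μ : Measure X) (h : X → ℝ) (a : ℤ) (j : ℕ) :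
    L.Adapted (a + j) (L.maxExpect μ h a j) := by
  induction j with
  | zero => exact L.adapted_expect μ _ h
  | succ j ih =>
    exact (ih.mono (n := a + (j + 1 : ℕ)) (by lia)).comp₂
      (L.adapted_expect μ (a + (j + 1 : ℕ)) h) fun R x ↦ if 2 * R < x then x else R

/-- Doob's maximal inequality. -/
theorem lintegral_maxExpect_rpow_le {μ : Measure X} (hμ : L.LocallyFinite μ) {h : X → ℝ}
    (hh : ∀ x, 0 ≤ h x) (hi : ∀ n, ∀ I ∈ L.atoms n, IntegrableOn h I μ) {p : ℝ} (hp : 1 < p)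
    (a : ℤ) (N : ℕ) :
    ∫⁻ x, ENNReal.ofReal (L.maxExpect μ h a N x ^ p) ∂μ ≤
      ENNReal.ofReal (2 ^ p / (p - 1)) * ∫⁻ x, ENNReal.ofReal (h x ^ p) ∂μ := by
  have hp' : 0 < p - 1 := by linarith
  by_cases hfin : ∫⁻ x, ENNReal.ofReal (h x ^ p) ∂μ = ∞
  · rw [hfin, ENNReal.mul_top]
    · exact le_top
    · rw [Ne, ENNReal.ofReal_eq_zero, not_le]
      positivity
  set ξ : ℕ → X → ℝ := fun j ↦ L.expect μ (a + j) h with hξ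
  set R : ℕ → X → ℝ := L.maxExpect μ h a with hR
  have hξ0 : ∀ x j, 0 ≤ ξ j x := fun x j ↦ L.expect_nonneg hh x
  have hR0 : ∀ j x, 0 ≤ R j x := fun j x ↦ lazyMax_nonneg (hξ0 x) j
  have hξa : ∀ j : ℕ, L.Adapted (a + j) (ξ j) := fun j ↦ L.adapted_expect μ _ h
  have hRa : ∀ j : ℕ, L.Adapted (a + j) (R j) := L.adapted_maxExpect μ h a
  have hVm : ∀ j, Measurable fun x ↦ R j x ^ p := fun j ↦ ((hRa j).comp (· ^ p)).measurable
  have hWa : ∀ j : ℕ, L.Adapted (a + j) fun x ↦ p / (p - 1) * (ξ j x * R j x ^ (p - 1)) :=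
    fun j ↦ (hξa j).comp₂ (hRa j) fun ξ R ↦ p / (p - 1) * (ξ * R ^ (p - 1))
  have hWm := fun j ↦ (hWa j).measurable
  set V : ℕ → ℝ≥0∞ := fun j ↦ ∫⁻ x, ENNReal.ofReal (R j x ^ p) ∂μ with hV
  set W : ℕ → ℝ≥0∞ := fun j ↦
    ∫⁻ x, ENNReal.ofReal (p / (p - 1) * (ξ j x * R j x ^ (p - 1))) ∂μ with hW
  have hj : ∀ j, ∫⁻ x, ENNReal.ofReal (ξ j x ^ p) ∂μ ≤ ∫⁻ x, ENNReal.ofReal (h x ^ p) ∂μ :=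
    fun j ↦ L.lintegral_expect_rpow_le hμ hh hi hp _
  have hRξ : ∀ x, R 0 x = ξ 0 x := fun x ↦ rfl
  have hpow : ∀ {y : ℝ}, 0 ≤ y → y * y ^ (p - 1) = y ^ p := fun {y} hy ↦ by
    rcases hy.eq_or_lt with rfl | hy
    · rw [zero_mul, Real.zero_rpow (by linarith)]
    · rw [Real.rpow_sub_one hy.ne', mul_div_cancel₀ _ hy.ne']
  -- Only qualitative: the bound deteriorates with `j`, but finiteness justifies the later
  -- cancellations and the absorption.
  have hVfin : ∀ j, V j ≠ ∞ := by
    intro j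
    induction j with
    | zero =>
      simp only [hV, hRξ]
      exact ne_top_of_le_ne_top hfin (hj 0)
    | succ j ih =>
      refine ne_top_of_le_ne_top (ENNReal.add_ne_top.2 ⟨ih, ne_top_of_le_ne_top hfin (hj (j + 1))⟩) ?_
      rw [hV, ← lintegral_add_left (hVm j).ennreal_ofReal]
      refine lintegral_mono fun x ↦ ?_
      rw [← ENNReal.ofReal_add (Real.rpow_nonneg (hR0 j x) p) (Real.rpow_nonneg (hξ0 x _) p)]
      exact ENNReal.ofReal_le_ofReal (lazyMax_succ_rpow_le (hξ0 x) j)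
  have hWfin : ∀ j, W j ≠ ∞ := by
    intro j
    refine ne_top_of_le_ne_top (ENNReal.mul_ne_top (ENNReal.ofReal_ne_top (r := p / (p - 1) * 2))
      (hVfin j)) ?_
    rw [hV, ← lintegral_const_mul _ (hVm j).ennreal_ofReal]
    refine lintegral_mono fun x ↦ ?_
    rw [← ENNReal.ofReal_mul (by positivity)]
    refine ENNReal.ofReal_le_ofReal ?_
    rw [mul_assoc, ← hpow (hR0 j x), ← mul_assoc 2]
    have := le_two_mul_lazyMax (hξ0 x) j
    have h1 : 0 ≤ R j x ^ (p - 1) := Real.rpow_nonneg (hR0 j x) _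
    gcongr
    exact this
  have hVW : ∀ j, V j ≤ W j := by
    intro j
    induction j with
    | zero =>
      refine lintegral_mono fun x ↦ ENNReal.ofReal_le_ofReal ?_
      rw [hRξ, hpow (hξ0 x 0)]
      have h1 : 1 ≤ p / (p - 1) := by rw [le_div_iff₀ hp']; linarith
      have h2 := Real.rpow_nonneg (hξ0 x 0) p
      nlinarith
    | succ j ih =>
      have hcast : a + ((j + 1 : ℕ) : ℤ) = a + j + 1 := by push_cast; ring
      have hstep := (L.isMartingaleDifference_martDiff μ hμ h hi).lintegral_le (n := a + j)
        (a := fun x ↦ -(p / (p - 1) * R j x ^ (p - 1)))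
        ((hRa j).comp fun R ↦ -(p / (p - 1) * R ^ (p - 1)))
        (u := fun x ↦ R (j + 1) x ^ p + p / (p - 1) * (ξ j x * R j x ^ (p - 1)))
        (v := fun x ↦ R j x ^ p + p / (p - 1) * (ξ (j + 1) x * R (j + 1) x ^ (p - 1)))
        ((hVm j).add (hWm (j + 1)))
        (fun x ↦ by have := hR0 j x; have := hR0 (j + 1) x; have := hξ0 x j; positivity)
        (fun x ↦ by have := hR0 j x; have := hR0 (j + 1) x; have := hξ0 x (j + 1); positivity)
        (Eventually.of_forall fun x ↦ by
          have := lazyMax_succ_add_le (hξ0 x) hp j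
          rw [RCLike.re_to_real, martDiff, ← hcast]
          exact this)
      have hsplit : ∀ i k : ℕ, ∫⁻ x, ENNReal.ofReal (R i x ^ p +
          p / (p - 1) * (ξ k x * R k x ^ (p - 1))) ∂μ = V i + W k := by
        intro i k
        rw [← lintegral_add_left (hVm i).ennreal_ofReal]
        refine lintegral_congr fun x ↦ ?_
        have := hR0 i x
        have := hR0 k x
        have := hξ0 x k
        rw [ENNReal.ofReal_add (by positivity) (by positivity)]
      rw [hsplit, hsplit] at hstep
      refine (ENNReal.add_le_add_iff_right (hWfin j)).1 (hstep.trans ?_)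
      rw [add_comm]
      gcongr
  have hWle : W N ≤ V N / 2 +
      ENNReal.ofReal (2 ^ p / (2 * (p - 1))) * ∫⁻ x, ENNReal.ofReal (h x ^ p) ∂μ := by
    have hξm : Measurable fun x ↦ ξ N x ^ p := ((hξa N).comp (· ^ p)).measurable
    calc W N ≤ ∫⁻ x, (ENNReal.ofReal (1 / 2) * ENNReal.ofReal (R N x ^ p) +
          ENNReal.ofReal (2 ^ p / (2 * (p - 1))) * ENNReal.ofReal (ξ N x ^ p)) ∂μ := by
          refine lintegral_mono fun x ↦ ?_
          have h1 := hR0 N x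
          have h2 := hξ0 x N
          rw [← ENNReal.ofReal_mul (by positivity), ← ENNReal.ofReal_mul (by positivity),
            ← ENNReal.ofReal_add (by positivity) (by positivity)]
          refine ENNReal.ofReal_le_ofReal ?_
          have := Real.mul_rpow_le_half_add hp h2 h1
          linarith
      _ = ENNReal.ofReal (1 / 2) * V N + ENNReal.ofReal (2 ^ p / (2 * (p - 1))) *
          ∫⁻ x, ENNReal.ofReal (ξ N x ^ p) ∂μ := by
          rw [lintegral_add_left ((hVm N).ennreal_ofReal.const_mul _),
            lintegral_const_mul _ (hVm N).ennreal_ofReal,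
            lintegral_const_mul _ hξm.ennreal_ofReal]
      _ ≤ _ := by
          have : ENNReal.ofReal (1 / 2) = 2⁻¹ := by
            rw [one_div, ENNReal.ofReal_inv_of_pos two_pos, ENNReal.ofReal_ofNat]
          rw [this, mul_comm, ← div_eq_mul_inv]
          exact add_le_add le_rfl (mul_le_mul' le_rfl (hj N))
  -- `V N` is at most half of itself plus the desired bound; the half is absorbed.
  have h1 := (hVW N).trans hWle
  nth_rewrite 1 [← ENNReal.add_halves (V N)] at h1
  have h2 := (ENNReal.add_le_add_iff_left
    (ENNReal.div_ne_top (hVfin N) two_ne_zero)).1 h1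
  calc V N = 2 * (V N / 2) := (ENNReal.mul_div_cancel two_ne_zero ENNReal.ofNat_ne_top).symm
    _ ≤ 2 * (ENNReal.ofReal (2 ^ p / (2 * (p - 1))) * ∫⁻ x, ENNReal.ofReal (h x ^ p) ∂μ) := by
        gcongr
    _ = _ := by
        rw [← mul_assoc, ← ENNReal.ofReal_ofNat 2, ← ENNReal.ofReal_mul (by norm_num)]
        congr 2
        field_simp

end AtomicFiltration

/-! ### The square function of a martingale is bounded by its limit. -/

section Scalar

theorem sq_mul_rpow_sub_two_le {p y R : ℝ} (hp : 1 < p) (hy : 0 ≤ y) (hyR : y ≤ 2 * R) :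
    y ^ 2 * R ^ (p - 2) ≤ 4 * R ^ p := by
  have hR : 0 ≤ R := by linarith
  rcases hR.eq_or_lt with rfl | hR
  · have : y = 0 := by linarith
    rw [this, Real.zero_rpow (x := p) (by linarith)]
    simp
  · have e : R ^ p = R ^ 2 * R ^ (p - 2) := by
      rw [← Real.rpow_natCast, ← Real.rpow_add hR]
      congr 1
      push_cast
      ring
    rw [e, ← mul_assoc]
    gcongr
    nlinarith

/-- The scalar inequality behind the bound of the square function by the martingale. -/
theorem lazyMax_norm_sq_add_le {𝕜 : Type*} [RCLike 𝕜] {x : ℕ → ℝ} (hx : ∀ j, 0 ≤ x j) {p : ℝ}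
    (hp : 1 < p) {j : ℕ} {f d : 𝕜} (hf : ‖f‖ ≤ 2 * lazyMax x j)
    (hfd : ‖f + d‖ ≤ 2 * lazyMax x (j + 1)) :
    ‖d‖ ^ 2 * lazyMax x (j + 1) ^ (p - 2) +
        (‖f‖ ^ 2 * lazyMax x j ^ (p - 2) + 46 * lazyMax x j ^ p) ≤
      ‖f + d‖ ^ 2 * lazyMax x (j + 1) ^ (p - 2) + 46 * lazyMax x (j + 1) ^ p +
        RCLike.re ((-(2 * lazyMax x j ^ (p - 2)) : ℝ) * star f * d) := by
  rw [mul_assoc (RCLike.ofReal _), RCLike.re_ofReal_mul]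
  have hR := lazyMax_nonneg hx j
  rcases lazyMax_succ_cases (x := x) j with h | ⟨-, h⟩
  · rw [h, RCLike.norm_add_sq']
    apply le_of_eq
    ring
  -- At a jump the identity for ‖f + d‖² is not needed: every term is bounded by a multiple of `R' ^
  -- p`. The multiples are 9, 2 and 2 * 6, in total 23, and 46 (R'^p - R^p) ≥ 23 R'^p because 2 R^p
  -- ≤ R'^p.
  · set R := lazyMax x j
    set R' := lazyMax x (j + 1)
    have hR' : 0 < R' := by linarith
    have hd : ‖d‖ ≤ 3 * R' := by
      have : ‖d‖ ≤ ‖f + d‖ + ‖f‖ := by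
        calc ‖d‖ = ‖(f + d) - f‖ := by rw [add_sub_cancel_left]
          _ ≤ _ := norm_sub_le _ _
      linarith
    have e : R' ^ p = R' ^ 2 * R' ^ (p - 2) := by
      rw [← Real.rpow_natCast, ← Real.rpow_add hR']
      congr 1
      push_cast
      ring
    have h1 : ‖d‖ ^ 2 * R' ^ (p - 2) ≤ 9 * R' ^ p := by
      rw [e, ← mul_assoc]
      gcongr
      nlinarith [norm_nonneg d]
    have h2 : ‖f‖ ^ 2 * R ^ (p - 2) ≤ 4 * R ^ p := sq_mul_rpow_sub_two_le hp (norm_nonneg f) hf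
    have h3 : 2 * R ^ p ≤ R' ^ p := two_mul_rpow_le_of_two_mul_lt hp.le hR h
    have h4 : R ^ (p - 2) * |RCLike.re (star f * d)| ≤ 6 * R' ^ p := by
      rcases hR.eq_or_lt with h0 | h0
      · have : f = 0 := by
          rw [← norm_le_zero_iff]
          linarith
        rw [this, star_zero, zero_mul, map_zero, abs_zero, mul_zero]
        positivity
      · have e1 : R ^ (p - 2) * R = R ^ (p - 1) := by
          rw [← Real.rpow_add_one h0.ne']
          congr 1
          ring
        have e2 : R' ^ (p - 1) * R' = R' ^ p := by
          rw [← Real.rpow_add_one hR'.ne']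
          congr 1
          ring
        calc R ^ (p - 2) * |RCLike.re (star f * d)| ≤ R ^ (p - 2) * (2 * R * (3 * R')) := by
              gcongr
              refine (RCLike.abs_re_le_norm _).trans ?_
              rw [norm_mul, norm_star]
              gcongr
          _ = 6 * (R ^ (p - 1) * R') := by rw [← e1]; ring
          _ ≤ 6 * (R' ^ (p - 1) * R') := by
              gcongr; linarith
          _ = _ := by rw [e2]
    have h5 := le_abs_self (RCLike.re (star f * d))
    have h6 : 0 ≤ R ^ (p - 2) := Real.rpow_nonneg hR _
    have h7 : R ^ (p - 2) * RCLike.re (star f * d) ≤ 6 * R' ^ p :=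
      (mul_le_mul_of_nonneg_left h5 h6).trans h4
    have h8 : 0 ≤ ‖f + d‖ ^ 2 * R' ^ (p - 2) := by positivity
    nlinarith

/-- If σ ≤ R² the second term suffices; otherwise σ^(p/2-1) ≤ R^(p-2), since the exponent is not
positive. It replaces a nonlinear function of the square sum by a linear one with weight `R ^ (p -
2)`. -/
theorem rpow_half_le_mul_add {p σ R : ℝ} (hp : 1 < p) (hp2 : p ≤ 2) (hσ : 0 ≤ σ) (hR : 0 < R) :
    σ ^ (p / 2) ≤ σ * R ^ (p - 2) + R ^ p := by
  have e : ∀ q : ℝ, (R ^ 2) ^ (q / 2) = R ^ q := fun q ↦ by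
    rw [← Real.rpow_natCast, ← Real.rpow_mul hR.le]
    congr 1
    push_cast
    ring
  rcases le_or_gt σ (R ^ 2) with h | h
  · have h1 : σ ^ (p / 2) ≤ (R ^ 2) ^ (p / 2) := Real.rpow_le_rpow hσ h (by linarith)
    rw [e] at h1
    have : 0 ≤ σ * R ^ (p - 2) := by positivity
    linarith
  · have hσ' : 0 < σ := lt_trans (by positivity) h
    have h1 : σ ^ ((p - 2) / 2) ≤ (R ^ 2) ^ ((p - 2) / 2) :=
      Real.rpow_le_rpow_of_nonpos (by positivity) h.le (by linarith)
    rw [e] at h1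
    have h2 : σ ^ (p / 2) = σ * σ ^ ((p - 2) / 2) := by
      rw [mul_comm, ← Real.rpow_add_one hσ'.ne']
      congr 1
      ring
    have : 0 ≤ R ^ p := by positivity
    rw [h2]
    nlinarith

end Scalar

namespace AtomicFiltration

variable {X : Type*} [MeasurableSpace X] {𝕜 : Type*} [RCLike 𝕜] {L : AtomicFiltration X}
  {ν : Measure X} {d : ℤ → X → 𝕜}

theorem Adapted.setIntegral {n : ℤ} {f : X → 𝕜} (hf : L.Adapted n f) {I : Set X}
    (hI : I ∈ L.atoms n) {x : X} (hx : x ∈ I) :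
    ∫ y in I, f y ∂ν = ν.real I • f x := by
  rw [setIntegral_congr_fun (L.measurableSet_atom hI) (fun y hy ↦ hf I hI y hy x hx),
    setIntegral_const]

/-- Identities with averages may fail on atoms of measure zero, where the average is zero by
convention; countably many such atoms do not matter. -/
theorem ae_restrict_of_measure_ne_zero {n : ℤ} {P : X → Prop}
    (h : ∀ I ∈ L.atoms n, ν I ≠ 0 → ∀ x ∈ I, P x) : ∀ᵐ x ∂ν, P x := by
  refine L.ae_of_atoms (n := n) fun I hI ↦ ?_
  by_cases h0 : ν I = 0
  · rw [Measure.restrict_eq_zero.2 h0]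
    exact ae_zero ▸ Filter.eventually_bot
  · exact ae_restrict_of_forall_mem (L.measurableSet_atom hI) (h I hI h0)

theorem setIntegral_expect_succ [IsFiniteMeasure ν] {b : X → 𝕜} (hb : Integrable b ν) {n : ℤ}
    {I : Set X} (hI : I ∈ L.atoms n) :
    ∫ x in I, L.expect ν (n + 1) b x ∂ν = ∫ x in I, b x ∂ν := by
  have hd := L.isMartingaleDifference_martDiff ν (fun _ _ _ ↦ measure_lt_top _ _) b
    fun _ _ _ ↦ hb.integrableOn
  obtain ⟨x, hx⟩ := L.nonempty_of_mem n I hI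
  have hE : IntegrableOn (L.expect ν n b) I ν :=
    (integrableOn_congr_fun (fun y hy ↦ L.adapted_expect ν n b I hI y hy x hx)
      (L.measurableSet_atom hI)).2 (integrableOn_const (measure_ne_top _ _))
  have h1 : ∀ y, L.expect ν (n + 1) b y = L.martDiff ν b n y + L.expect ν n b y :=
    fun y ↦ by rw [martDiff, sub_add_cancel]
  simp_rw [h1]
  rw [integral_add (hd.integrableOn n I hI) hE, hd.integral_eq_zero n I hI, zero_add,
    (L.adapted_expect ν n b).setIntegral hI hx, L.expect_eq ν hI hx]
  exact measure_smul_setAverage b (measure_ne_top _ _)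

/-- If a martingale is integrable at some time, then its earlier values are the conditional
expectations. -/
theorem IsMartingaleDifference.sum_ae_eq_expect_sum [IsFiniteMeasure ν]
    (hd : L.IsMartingaleDifference ν d) {a : ℤ} {M : ℕ}
    (hM : Integrable (fun x ↦ ∑ j ∈ Finset.range M, d (a + j) x) ν) {N : ℕ} (hNM : N ≤ M) :
    (fun x ↦ ∑ j ∈ Finset.range N, d (a + j) x) =ᵐ[ν]
      L.expect ν (a + N) fun x ↦ ∑ j ∈ Finset.range M, d (a + j) x := by
  set g : ℕ → X → 𝕜 := fun N x ↦ ∑ j ∈ Finset.range N, d (a + j) x with hg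
  have hga : ∀ N : ℕ, L.Adapted (a + N) (g N) := hd.adapted_sum a
  change g N =ᵐ[ν] L.expect ν (a + N) (g M)
  have hν : ∀ I, ν I ≠ 0 → ν.real I ≠ 0 := fun I h ↦ by
    rw [measureReal_def]
    exact ENNReal.toReal_ne_zero.2 ⟨h, measure_ne_top _ _⟩
  -- The induction goes down from `M`, the only time at which integrability is known: the integral
  -- of `g (N + 1)` over an atom is already that of `g M`.
  induction hNM using Nat.decreasingInduction with
  | self =>
    refine ae_restrict_of_measure_ne_zero (L := L) (n := a + M) fun I hI h0 x hx ↦ ?_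
    rw [L.expect_eq ν hI hx]
    have h1 := measure_smul_setAverage (g M) (measure_ne_top ν I)
    rw [(hga M).setIntegral hI hx] at h1
    exact (smul_right_injective 𝕜 (hν I h0) h1).symm
  | of_succ N hN ih =>
    refine ae_restrict_of_measure_ne_zero (L := L) (n := a + N) fun I hI h0 x hx ↦ ?_
    rw [L.expect_eq ν hI hx]
    have h1 := measure_smul_setAverage (g M) (measure_ne_top ν I)
    have h2 : ∫ y in I, g (N + 1) y ∂ν = ∫ y in I, g M y ∂ν := by
      rw [← setIntegral_expect_succ hM hI]
      have : a + (N : ℤ) + 1 = a + (N + 1 : ℕ) := by push_cast; ring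
      rw [this]
      exact integral_congr_ae (ae_restrict_of_ae ih)
    have h3 : ∫ y in I, g (N + 1) y ∂ν = ν.real I • g N x := by
      have hi : IntegrableOn (g N) I ν :=
        (integrableOn_congr_fun (fun y hy ↦ hga N I hI y hy x hx)
          (L.measurableSet_atom hI)).2 (integrableOn_const (measure_ne_top _ _))
      simp only [hg, Finset.sum_range_succ]
      rw [integral_add hi (hd.integrableOn _ I hI), hd.integral_eq_zero _ I hI, add_zero]
      exact (hga N).setIntegral hI hx
    rw [← h2, h3] at h1
    exact (smul_right_injective 𝕜 (hν I h0) h1).symm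

/-- Let M → ∞ in the identity for finite times: averages over a fixed atom are continuous in L^1. -/
theorem IsMartingaleDifference.sum_ae_eq_expect [IsFiniteMeasure ν]
    (hd : L.IsMartingaleDifference ν d) {a : ℤ} {s : X → 𝕜} (hs : Integrable s ν)
    (hlim : Tendsto (fun M : ℕ ↦
      eLpNorm ((fun x ↦ ∑ j ∈ Finset.range M, d (a + j) x) - s) 1 ν) atTop (𝓝 0)) (N : ℕ) :
    (fun x ↦ ∑ j ∈ Finset.range N, d (a + j) x) =ᵐ[ν] L.expect ν (a + N) s := by
  set g : ℕ → X → 𝕜 := fun N x ↦ ∑ j ∈ Finset.range N, d (a + j) x with hg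
  have hga : ∀ N : ℕ, L.Adapted (a + N) (g N) := hd.adapted_sum a
  -- Differences are assumed integrable on single atoms only, so global integrability of `g M` has
  -- to come from its distance to `s`.
  have hint : ∀ᶠ M in atTop, Integrable (g M) ν := by
    filter_upwards [hlim.eventually (gt_mem_nhds ENNReal.zero_lt_top)] with M hM
    have h1 : MemLp (g M - s) 1 ν :=
      ⟨(hga M).measurable.aestronglyMeasurable.sub hs.aestronglyMeasurable, hM⟩
    simpa using (memLp_one_iff_integrable.1 h1).add hs
  have hae : ∀ᵐ x ∂ν, ∀ M, Integrable (g M) ν → N ≤ M → g N x = L.expect ν (a + N) (g M) x := by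
    rw [ae_all_iff]
    intro M
    by_cases h : Integrable (g M) ν ∧ N ≤ M
    · filter_upwards [hd.sum_ae_eq_expect_sum h.1 h.2] with x hx _ _
      exact hx
    · exact Eventually.of_forall fun x h1 h2 ↦ absurd ⟨h1, h2⟩ h
  filter_upwards [hae] with x hx
  obtain ⟨I, hI, hxI⟩ := L.exists_mem_atoms (a + N) x
  have hl : Tendsto (fun M ↦ L.expect ν (a + N) (g M) x) atTop (𝓝 (L.expect ν (a + N) s x)) := by
    simp_rw [L.expect_eq ν hI hxI, setAverage_eq]
    exact (tendsto_setIntegral_of_L1' s hs.aestronglyMeasurable hint hlim I).const_smul _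
  refine tendsto_nhds_unique (tendsto_const_nhds.congr' ?_) hl
  filter_upwards [hint, eventually_ge_atTop N] with M h1 h2
  exact hx M h1 h2

/-- For `1 < p ≤ 2`, the square function of a martingale is bounded in `L^p` by the limit of the
martingale. -/
theorem IsMartingaleDifference.lintegral_square_rpow_le [IsFiniteMeasure ν]
    (hd : L.IsMartingaleDifference ν d) {p : ℝ} (hp : 1 < p) (hp2 : p ≤ 2) {a : ℤ} {s : X → 𝕜}
    (hs : Integrable s ν)
    (hlim : Tendsto (fun M : ℕ ↦
      eLpNorm ((fun x ↦ ∑ j ∈ Finset.range M, d (a + j) x) - s) 1 ν) atTop (𝓝 0)) (N : ℕ) :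
    ∫⁻ x, ENNReal.ofReal ((∑ j ∈ Finset.range N, ‖d (a + j) x‖ ^ 2) ^ (p / 2)) ∂ν ≤
      51 * (ENNReal.ofReal (2 ^ p / (p - 1)) * ∫⁻ x, ENNReal.ofReal (‖s x‖ ^ p) ∂ν) := by
  set g : ℕ → X → 𝕜 := fun N x ↦ ∑ j ∈ Finset.range N, d (a + j) x with hg
  have hga : ∀ N : ℕ, L.Adapted (a + N) (g N) := hd.adapted_sum a
  set ξ : ℕ → X → ℝ := fun j ↦ L.expect ν (a + j) (fun y ↦ ‖s y‖) with hξ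
  set R : ℕ → X → ℝ := L.maxExpect ν (fun y ↦ ‖s y‖) a with hR
  have hξ0 : ∀ x j, 0 ≤ ξ j x := fun x j ↦ L.expect_nonneg (fun y ↦ norm_nonneg _) x
  have hR0 : ∀ j x, 0 ≤ R j x := fun j x ↦ lazyMax_nonneg (hξ0 x) j
  have hRa : ∀ j : ℕ, L.Adapted (a + j) (R j) := L.adapted_maxExpect ν _ a
  have hcast : ∀ j : ℕ, a + ((j + 1 : ℕ) : ℤ) = a + j + 1 := fun j ↦ by push_cast; ring
  -- `g j` is the average of `s`, hence dominated by the average of ‖s‖, whose lazy maximum is `R`.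
  have hgR : ∀ᵐ x ∂ν, ∀ j, ‖g j x‖ ≤ 2 * R j x := by
    rw [ae_all_iff]
    intro j
    filter_upwards [hd.sum_ae_eq_expect hs hlim j] with x hx
    change g j x = _ at hx
    rw [hx]
    exact (L.norm_expect_le _ _ _ _).trans (le_two_mul_lazyMax (hξ0 x) j)
  have hsucc : ∀ j x, g (j + 1) x = g j x + d (a + j) x := fun j x ↦ Finset.sum_range_succ _ _
  set q : ℕ → X → ℝ := fun j x ↦ ‖d (a + j) x‖ ^ 2 * R (j + 1) x ^ (p - 2) with hq
  set V : ℕ → X → ℝ := fun j x ↦ ‖g j x‖ ^ 2 * R j x ^ (p - 2) + 46 * R j x ^ p with hV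
  have hq0 : ∀ j x, 0 ≤ q j x := fun j x ↦ by have := hR0 (j + 1) x; positivity
  have hV0 : ∀ j x, 0 ≤ V j x := fun j x ↦ by have := hR0 j x; positivity
  have hqm : ∀ j, Measurable (q j) := fun j ↦ by
    have h1 := hRa (j + 1)
    rw [hcast] at h1
    exact ((hd.adapted _).comp₂ h1 fun d R ↦ ‖d‖ ^ 2 * R ^ (p - 2)).measurable
  have hVm : ∀ j, Measurable (V j) := fun j ↦
    ((hga j).comp₂ (hRa j) fun g R ↦ ‖g‖ ^ 2 * R ^ (p - 2) + 46 * R ^ p).measurable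
  have hRm : ∀ j, Measurable fun x ↦ R j x ^ p := fun j ↦ ((hRa j).comp (· ^ p)).measurable
  have hstep : ∀ j, ∫⁻ x, ENNReal.ofReal (q j x) ∂ν + ∫⁻ x, ENNReal.ofReal (V j x) ∂ν ≤
      ∫⁻ x, ENNReal.ofReal (V (j + 1) x) ∂ν := by
    intro j
    rw [← lintegral_add_left (hqm j).ennreal_ofReal]
    simp_rw [← ENNReal.ofReal_add (hq0 j _) (hV0 j _)]
    refine hd.lintegral_le (n := a + j)
      (a := fun x ↦ ((-(2 * R j x ^ (p - 2)) : ℝ) : 𝕜) * star (g j x))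
      ((hga j).comp₂ (hRa j) fun g R ↦ ((-(2 * R ^ (p - 2)) : ℝ) : 𝕜) * star g) (hVm (j + 1))
      (fun x ↦ add_nonneg (hq0 j x) (hV0 j x)) (hV0 (j + 1)) ?_
    filter_upwards [hgR] with x hx
    have h2 := hx (j + 1)
    simp only [hV, hq]
    rw [hsucc] at h2 ⊢
    exact lazyMax_norm_sq_add_le (hξ0 x) hp (hx j) h2
  have hsum : ∀ N, ∑ j ∈ Finset.range N, ∫⁻ x, ENNReal.ofReal (q j x) ∂ν ≤
      ∫⁻ x, ENNReal.ofReal (V N x) ∂ν := by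
    intro N
    induction N with
    | zero => simp
    | succ N ih =>
      rw [Finset.sum_range_succ, add_comm]
      exact (add_le_add le_rfl ih).trans (hstep N)
  -- 50 = 4 + 46, with 4 from ‖g‖ ≤ 2 R.
  have hVle : ∫⁻ x, ENNReal.ofReal (V N x) ∂ν ≤ 50 * ∫⁻ x, ENNReal.ofReal (R N x ^ p) ∂ν := by
    rw [← lintegral_const_mul _ (hRm N).ennreal_ofReal]
    refine lintegral_mono_ae ?_
    filter_upwards [hgR] with x hx
    rw [← ENNReal.ofReal_ofNat, ← ENNReal.ofReal_mul (by norm_num)]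
    refine ENNReal.ofReal_le_ofReal ?_
    have := sq_mul_rpow_sub_two_le hp (norm_nonneg _) (hx N)
    simp only [hV]
    linarith
  have hpt : ∀ᵐ x ∂ν, (∑ j ∈ Finset.range N, ‖d (a + j) x‖ ^ 2) ^ (p / 2) ≤
      ∑ j ∈ Finset.range N, q j x + R N x ^ p := by
    filter_upwards [hgR] with x hx
    have hdR : ∀ j : ℕ, ‖d (a + j) x‖ ≤ 2 * R j x + 2 * R (j + 1) x := fun j : ℕ ↦ by
      have : d (a + j) x = g (j + 1) x - g j x := by rw [hsucc, add_sub_cancel_left]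
      rw [this]
      linarith [norm_sub_le (g (j + 1) x) (g j x), hx j, hx (j + 1)]
    have hmono : Monotone fun j ↦ R j x := lazyMax_mono (hξ0 x)
    -- Where `R` vanishes so does the increment, and the value of `0 ^ (p - 2)` is harmless.
    have hd0 : ∀ j, R (j + 1) x = 0 → ‖d (a + j) x‖ = 0 := fun j h ↦ by
      have h1 : R j x ≤ R (j + 1) x := hmono (Nat.le_succ j)
      have h2 := hdR j
      have h3 := hR0 j x
      exact le_antisymm (by linarith) (norm_nonneg _)
    rcases (hR0 N x).eq_or_lt with h | h
    · have hz : ∑ j ∈ Finset.range N, ‖d (a + j) x‖ ^ 2 = 0 := by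
        refine Finset.sum_eq_zero fun j hj ↦ ?_
        have h1 : R (j + 1) x ≤ R N x := hmono (Finset.mem_range.1 hj)
        rw [hd0 j (le_antisymm (h1.trans h.ge) (hR0 _ x))]
        simp
      rw [hz, Real.zero_rpow (by linarith)]
      exact add_nonneg (Finset.sum_nonneg fun j _ ↦ hq0 j x) (Real.rpow_nonneg (hR0 N x) p)
    -- `R` increases and p ≤ 2, so the weight at the final time is at most the weight at time j + 1.
    · refine (rpow_half_le_mul_add hp hp2 (Finset.sum_nonneg fun j _ ↦ by positivity) h).trans ?_
      rw [Finset.sum_mul]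
      gcongr with j hj
      simp only [hq]
      rcases (hR0 (j + 1) x).eq_or_lt with h0 | h0
      · rw [hd0 j h0.symm]
        simp
      · gcongr ?_ * ?_
        exact Real.rpow_le_rpow_of_nonpos h0 (hmono (Finset.mem_range.1 hj)) (by linarith)
  calc _ ≤ ∫⁻ x, (∑ j ∈ Finset.range N, ENNReal.ofReal (q j x) + ENNReal.ofReal (R N x ^ p)) ∂ν := by
        refine lintegral_mono_ae ?_
        filter_upwards [hpt] with x hx
        rw [← ENNReal.ofReal_sum_of_nonneg fun j _ ↦ hq0 j x, ← ENNReal.ofReal_add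
          (Finset.sum_nonneg fun j _ ↦ hq0 j x) (Real.rpow_nonneg (hR0 N x) p)]
        exact ENNReal.ofReal_le_ofReal hx
    _ = ∑ j ∈ Finset.range N, ∫⁻ x, ENNReal.ofReal (q j x) ∂ν +
        ∫⁻ x, ENNReal.ofReal (R N x ^ p) ∂ν := by
        rw [lintegral_add_right _ (hRm N).ennreal_ofReal,
          lintegral_finsetSum _ fun j _ ↦ (hqm j).ennreal_ofReal]
    _ ≤ 50 * ∫⁻ x, ENNReal.ofReal (R N x ^ p) ∂ν + ∫⁻ x, ENNReal.ofReal (R N x ^ p) ∂ν :=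
        add_le_add ((hsum N).trans hVle) le_rfl
    _ = 51 * ∫⁻ x, ENNReal.ofReal (R N x ^ p) ∂ν := by ring
    _ ≤ _ := by
        gcongr
        exact L.lintegral_maxExpect_rpow_le (fun _ _ _ ↦ measure_lt_top _ _)
          (fun _ ↦ norm_nonneg _) (fun _ _ _ ↦ hs.norm.integrableOn) hp a N

/-- The martingale differences from generation `k` on, restricted to an atom of generation `k`. -/
theorem IsMartingaleDifference.restrict (hd : L.IsMartingaleDifference ν d) {k : ℤ} {J : Set X}
    (hJ : J ∈ L.atoms k) :
    L.IsMartingaleDifference (ν.restrict J) fun n x ↦ if k ≤ n then d n x else 0 := by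
  -- From generation k on, an atom lies inside `J` or misses it. Earlier differences are cut off
  -- because their integral over `J` need not vanish.
  have hres : ∀ n, k ≤ n → ∀ I ∈ L.atoms n,
      (ν.restrict J).restrict I = ν.restrict I ∨ (ν.restrict J).restrict I = 0 := by
    intro n hn I hI
    rw [Measure.restrict_restrict (L.measurableSet_atom hI)]
    rcases (I ∩ J).eq_empty_or_nonempty with h | ⟨x, hxI, hxJ⟩
    · right
      rw [h, Measure.restrict_empty]
    · left
      rw [Set.inter_eq_left.2 (L.subset_of_mem_atoms hn hI hJ hxI hxJ)]
  refine ⟨fun n I hI ↦ ?_, fun n I hI x hx y hy ↦ ?_, fun n I hI ↦ ?_⟩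
  · by_cases hn : k ≤ n
    · simp only [hn, if_true]
      rcases hres n hn I hI with h | h
      · rw [IntegrableOn, h]
        exact hd.integrableOn n I hI
      · rw [IntegrableOn, h]
        exact integrable_zero_measure
    · simp [hn]
  · by_cases hn : k ≤ n
    · simp only [hn, if_true]
      exact hd.const_on_children n I hI x hx y hy
    · simp [hn]
  · by_cases hn : k ≤ n
    · simp only [hn, if_true]
      rcases hres n hn I hI with h | h
      · rw [h]
        exact hd.integral_eq_zero n I hI
      · rw [h, integral_zero_measure]
    · simp [hn]

theorem sum_range_restrict {Y M : Type*} [AddCommMonoid M] (k : ℤ) (d : ℤ → Y → 𝕜) (x : Y)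
    (F : 𝕜 → M) (N : ℕ) :
    ∑ j ∈ Finset.range N, F (if k ≤ k + (j : ℤ) then d (k + j) x else 0) =
      ∑ j ∈ Finset.range N, F (d (k + j) x) :=
  Finset.sum_congr rfl fun j _ ↦ by rw [if_pos (by lia)]

theorem sum_Ico_eq_sum_range {M : Type*} [AddCommMonoid M] (k : ℤ) (N : ℕ) (F : ℤ → M) :
    ∑ n ∈ Finset.Ico k (k + N), F n = ∑ j ∈ Finset.range N, F (k + j) := by
  refine (Finset.sum_nbij (fun j : ℕ ↦ k + (j : ℤ)) (fun j hj ↦ ?_) (fun i _ j _ h ↦ ?_)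
    (fun n hn ↦ ?_) fun _ _ ↦ rfl).symm
  · have := Finset.mem_range.1 hj
    rw [Finset.mem_Ico]
    lia
  · simpa using h
  · rw [Finset.mem_coe, Finset.mem_Ico] at hn
    refine ⟨(n - k).toNat, ?_, ?_⟩
    · rw [Finset.mem_coe, Finset.mem_range]
      lia
    · change k + ((n - k).toNat : ℤ) = n
      lia

theorem setLIntegral_square_rpow_le (hν : L.LocallyFinite ν)
    (hd : L.IsMartingaleDifference ν d) {p : ℝ} (hp : 1 < p) (hp2 : p ≤ 2) {k : ℤ} {J : Set X}
    (hJ : J ∈ L.atoms k) {s : X → 𝕜} (hs : IsLocalSum ν d k J s)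
    (hfin : ∫⁻ x in J, ‖s x‖ₑ ^ p ∂ν ≠ ∞) (N : ℕ) :
    ∫⁻ x in J, ENNReal.ofReal ((∑ j ∈ Finset.range N, ‖d (k + j) x‖ ^ 2) ^ (p / 2)) ∂ν ≤
      51 * (ENNReal.ofReal (2 ^ p / (p - 1)) * ∫⁻ x in J, ‖s x‖ₑ ^ p ∂ν) := by
  have : IsFiniteMeasure (ν.restrict J) := isFiniteMeasure_restrict.2 (hν k J hJ).ne
  have hp0 : 0 < p := by linarith
  have hsi : Integrable s (ν.restrict J) := by
    have : MemLp s (ENNReal.ofReal p) (ν.restrict J) := by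
      refine ⟨hs.1, ?_⟩
      rw [eLpNorm_lt_top_iff_lintegral_rpow_enorm_lt_top (by simpa using hp0)
        ENNReal.ofReal_ne_top, ENNReal.toReal_ofReal hp0.le]
      exact lt_top_iff_ne_top.2 hfin
    exact this.integrable (by simpa using hp.le)
  have h := (hd.restrict hJ).lintegral_square_rpow_le hp hp2 (a := k) hsi ?_ N
  · simp_rw [sum_range_restrict k d _ (fun z ↦ ‖z‖ ^ 2)] at h
    refine h.trans_eq ?_
    congr 3 with x
    rw [← ENNReal.ofReal_rpow_of_nonneg (norm_nonneg _) hp0.le, ofReal_norm]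
  · have h1 := hs.2.comp (tendsto_atTop_add_const_left atTop k
      (tendsto_natCast_atTop_atTop (R := ℤ)))
    refine h1.congr fun M ↦ ?_
    simp only [Function.comp]
    congr 2
    ext x
    rw [Finset.sum_apply, sum_Ico_eq_sum_range k M fun n ↦ d n x]
    exact (sum_range_restrict k d x id M).symm

end AtomicFiltration

/-! ### Summation by parts, and the square function of the paraproduct. -/

section Scalar

theorem Real.sum_rpow_le {ι : Type*} (s : Finset ι) {f : ι → ℝ} (hf : ∀ i ∈ s, 0 ≤ f i) {θ : ℝ}
    (h0 : 0 < θ) (h1 : θ ≤ 1) : (∑ i ∈ s, f i) ^ θ ≤ ∑ i ∈ s, f i ^ θ := by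
  classical
  induction s using Finset.induction_on with
  | empty => simp [Real.zero_rpow h0.ne']
  | insert i s hi ih =>
    rw [Finset.sum_insert hi, Finset.sum_insert hi]
    have h2 := ih fun j hj ↦ hf j (Finset.mem_insert_of_mem hj)
    have h3 := hf i (Finset.mem_insert_self i s)
    have h4 : 0 ≤ ∑ j ∈ s, f j := Finset.sum_nonneg fun j hj ↦ hf j (Finset.mem_insert_of_mem hj)
    exact (Real.rpow_add_le_add_rpow h3 h4 h0.le h1).trans (by linarith)

/-- The sequence of the lazy maxima, preceded by `0`. -/
noncomputable def lazyMaxPrev (x : ℕ → ℝ) : ℕ → ℝ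
  | 0 => 0
  | j + 1 => lazyMax x j

theorem lazyMaxPrev_nonneg {x : ℕ → ℝ} (hx : ∀ j, 0 ≤ x j) (m : ℕ) : 0 ≤ lazyMaxPrev x m := by
  cases m with
  | zero => exact le_rfl
  | succ j => exact lazyMax_nonneg hx j

theorem lazyMaxPrev_succ_cases {x : ℕ → ℝ} (hx : ∀ j, 0 ≤ x j) {p : ℝ} (hp : 1 < p) (m : ℕ) :
    lazyMaxPrev x (m + 1) = lazyMaxPrev x m ∨ (lazyMaxPrev x m ≤ lazyMaxPrev x (m + 1) ∧
      2 * lazyMaxPrev x m ^ p ≤ lazyMaxPrev x (m + 1) ^ p) := by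
  cases m with
  | zero =>
    right
    have := hx 0
    simp only [lazyMaxPrev, lazyMax, Real.zero_rpow (show p ≠ 0 by linarith), mul_zero]
    exact ⟨this, by positivity⟩
  | succ j =>
    rcases lazyMax_succ_cases (x := x) j with h | ⟨-, h⟩
    · exact Or.inl h
    · exact Or.inr ⟨lazyMax_le_succ hx j,
        two_mul_rpow_le_of_two_mul_lt hp.le (lazyMax_nonneg hx j) h⟩

/-- Both differences vanish unless the maximum jumps, and at a jump `R ^ p` is at most twice `R ^ p
- r ^ p`. This is the reason for the lazy maximum. -/
theorem lazyMaxPrev_sq_sub_rpow_le {x : ℕ → ℝ} (hx : ∀ j, 0 ≤ x j) {p : ℝ} (hp : 1 < p) (m : ℕ) :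
    0 ≤ lazyMaxPrev x (m + 1) ^ 2 - lazyMaxPrev x m ^ 2 ∧
    0 ≤ lazyMaxPrev x (m + 1) ^ p - lazyMaxPrev x m ^ p ∧
    (lazyMaxPrev x (m + 1) ^ 2 - lazyMaxPrev x m ^ 2) ^ (p / 2) ≤
      2 * (lazyMaxPrev x (m + 1) ^ p - lazyMaxPrev x m ^ p) := by
  rcases lazyMaxPrev_succ_cases hx hp m with h | ⟨h1, h2⟩
  · rw [h]
    simp [Real.zero_rpow (show p / 2 ≠ 0 by linarith)]
  · have h3 := lazyMaxPrev_nonneg hx m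
    set r := lazyMaxPrev x m
    set R := lazyMaxPrev x (m + 1)
    have hR : 0 ≤ R := h3.trans h1
    have h4 : 0 ≤ R ^ 2 - r ^ 2 := by nlinarith
    have h5 : 0 ≤ r ^ p := by positivity
    refine ⟨h4, by linarith, ?_⟩
    calc (R ^ 2 - r ^ 2) ^ (p / 2) ≤ (R ^ 2) ^ (p / 2) :=
          Real.rpow_le_rpow h4 (by nlinarith) (by linarith)
      _ = R ^ p := by
          rw [← Real.rpow_natCast, ← Real.rpow_mul hR]
          congr 1
          push_cast
          ring
      _ ≤ _ := by linarith

/-- Summation by parts. -/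
theorem rpow_sum_lazyMax_le {x : ℕ → ℝ} (hx : ∀ j, 0 ≤ x j) {p : ℝ} (hp : 1 < p) (hp2 : p ≤ 2)
    {D : ℕ → ℝ} (hD : ∀ j, 0 ≤ D j) (N : ℕ) :
    (∑ j ∈ Finset.range N, x j ^ 2 * D j) ^ (p / 2) ≤
      ∑ m ∈ Finset.range N, 8 * (lazyMaxPrev x (m + 1) ^ p - lazyMaxPrev x m ^ p) *
        (∑ i ∈ Finset.range (N - m), D (m + i)) ^ (p / 2) := by
  have hR := lazyMax_nonneg hx
  -- The leading zero of `lazyMaxPrev` lets the sum telescope without a boundary term; index `m + 1`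
  -- there is generation `m` of `lazyMax`.
  have hsq : ∀ j, lazyMax x j ^ 2 = ∑ m ∈ Finset.range (j + 1),
      (lazyMaxPrev x (m + 1) ^ 2 - lazyMaxPrev x m ^ 2) := fun j ↦ by
    rw [Finset.sum_range_sub fun m ↦ lazyMaxPrev x m ^ 2]
    simp [lazyMaxPrev]
  have h4 : (4 : ℝ) ^ (p / 2) ≤ 4 := by
    calc (4 : ℝ) ^ (p / 2) ≤ 4 ^ (1 : ℝ) :=
          Real.rpow_le_rpow_of_exponent_le (by norm_num) (by linarith)
      _ = 4 := Real.rpow_one 4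
  have hΔ := lazyMaxPrev_sq_sub_rpow_le hx hp
  have hT : ∀ m, 0 ≤ ∑ i ∈ Finset.range (N - m), D (m + i) :=
    fun m ↦ Finset.sum_nonneg fun i _ ↦ hD _
  calc (∑ j ∈ Finset.range N, x j ^ 2 * D j) ^ (p / 2)
      ≤ (4 * ∑ j ∈ Finset.range N, lazyMax x j ^ 2 * D j) ^ (p / 2) := by
        refine Real.rpow_le_rpow (Finset.sum_nonneg fun j _ ↦ mul_nonneg (sq_nonneg _) (hD j)) ?_
          (by linarith)
        rw [Finset.mul_sum]
        refine Finset.sum_le_sum fun j _ ↦ ?_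
        rw [← mul_assoc]
        refine mul_le_mul_of_nonneg_right ?_ (hD j)
        nlinarith [le_two_mul_lazyMax hx j, hx j]
    _ = 4 ^ (p / 2) * (∑ j ∈ Finset.range N, lazyMax x j ^ 2 * D j) ^ (p / 2) :=
        Real.mul_rpow (by norm_num)
          (Finset.sum_nonneg fun j _ ↦ mul_nonneg (sq_nonneg _) (hD j))
    _ ≤ 4 * (∑ j ∈ Finset.range N, lazyMax x j ^ 2 * D j) ^ (p / 2) := by
        refine mul_le_mul_of_nonneg_right h4 (Real.rpow_nonneg ?_ _)
        exact Finset.sum_nonneg fun j _ ↦ mul_nonneg (sq_nonneg _) (hD j)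
    _ = 4 * (∑ m ∈ Finset.range N, (lazyMaxPrev x (m + 1) ^ 2 - lazyMaxPrev x m ^ 2) *
          ∑ i ∈ Finset.range (N - m), D (m + i)) ^ (p / 2) := by
        congr 2
        simp_rw [hsq, Finset.sum_mul]
        rw [Finset.sum_comm' (s' := fun m ↦ Finset.Ico m N) (t' := Finset.range N)
          (fun j m ↦ by simp only [Finset.mem_range, Finset.mem_Ico]; lia)]
        refine Finset.sum_congr rfl fun m _ ↦ ?_
        rw [← Finset.mul_sum, Finset.sum_Ico_eq_sum_range]
    _ ≤ 4 * ∑ m ∈ Finset.range N, ((lazyMaxPrev x (m + 1) ^ 2 - lazyMaxPrev x m ^ 2) *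
          ∑ i ∈ Finset.range (N - m), D (m + i)) ^ (p / 2) := by
        gcongr
        exact Real.sum_rpow_le _ (fun m _ ↦ mul_nonneg (hΔ m).1 (hT m)) (by linarith) (by linarith)
    _ ≤ _ := by
        rw [Finset.mul_sum]
        refine Finset.sum_le_sum fun m _ ↦ ?_
        rw [Real.mul_rpow (hΔ m).1 (hT m), ← mul_assoc]
        refine mul_le_mul_of_nonneg_right ?_ (Real.rpow_nonneg (hT m) _)
        linarith [(hΔ m).2.2]

end Scalar

namespace AtomicFiltration

variable {X : Type*} [MeasurableSpace X] {𝕜 : Type*} [RCLike 𝕜] {L : AtomicFiltration X}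
  {μ ν : Measure X} {d : ℤ → X → 𝕜}

/-- On each atom `w` is a constant and comes out of the integral. Here the estimate passes from ν to
μ. -/
theorem Adapted.lintegral_mul_le {n : ℤ} {w T : X → ℝ≥0∞} (hw : L.Adapted n w)
    (hT : Measurable T) {c : ℝ≥0∞} (h : ∀ J ∈ L.atoms n, ∫⁻ x in J, T x ∂ν ≤ c * μ J) :
    ∫⁻ x, w x * T x ∂ν ≤ c * ∫⁻ x, w x ∂μ := by
  rw [← lintegral_const_mul _ hw.measurable]
  refine L.lintegral_mono_of_atoms (n := n) fun J hJ ↦ ?_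
  obtain ⟨y, hy⟩ := L.nonempty_of_mem n J hJ
  have h1 : Set.EqOn (fun x ↦ w x * T x) (fun x ↦ w y * T x) J := fun x hx ↦ by
    simp only [hw J hJ x hx y hy]
  have h2 : Set.EqOn (fun x ↦ c * w x) (fun _ ↦ c * w y) J := fun x hx ↦ by
    simp only [hw J hJ x hx y hy]
  rw [setLIntegral_congr_fun (L.measurableSet_atom hJ) h1,
    setLIntegral_congr_fun (L.measurableSet_atom hJ) h2,
    lintegral_const_mul _ hT, setLIntegral_const]
  calc w y * ∫⁻ x in J, T x ∂ν ≤ w y * (c * μ J) := by gcongr; exact h J hJ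
    _ = _ := by ring

/-- The testing condition bounds the square function of the paraproduct. -/
theorem Testing.lintegral_square_le {p : ℝ} {B : ℝ≥0} (hT : L.Testing μ ν d p B)
    (hμ : L.LocallyFinite μ) (hν : L.LocallyFinite ν) (hd : L.IsMartingaleDifference ν d)
    (hp : 1 < p) (hp2 : p ≤ 2) {f : X → 𝕜} (hf : ∀ n, ∀ I ∈ L.atoms n, IntegrableOn f I μ)
    (a : ℤ) (N : ℕ) :
    ∫⁻ x, ENNReal.ofReal
        ((∑ j ∈ Finset.range N, ‖L.expect μ (a + j) f x * d (a + j) x‖ ^ 2) ^ (p / 2)) ∂ν ≤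
      408 * ENNReal.ofReal (2 ^ p / (p - 1)) ^ 2 * B ^ p * ∫⁻ x, ‖f x‖ₑ ^ p ∂μ := by
  have hp0 : 0 < p := by linarith
  set K := ENNReal.ofReal (2 ^ p / (p - 1)) with hK
  set ξ : X → ℕ → ℝ := fun x j ↦ L.expect μ (a + j) (fun y ↦ ‖f y‖) x with hξ
  have hξ0 : ∀ x j, 0 ≤ ξ x j := fun x j ↦ L.expect_nonneg (fun y ↦ norm_nonneg _) x
  set ρ : ℕ → X → ℝ := fun m x ↦ lazyMaxPrev (ξ x) m with hρ
  set w : ℕ → X → ℝ := fun m x ↦ 8 * (ρ (m + 1) x ^ p - ρ m x ^ p) with hw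
  have hw0 : ∀ m x, 0 ≤ w m x := fun m x ↦
    mul_nonneg (by norm_num) (lazyMaxPrev_sq_sub_rpow_le (hξ0 x) hp m).2.1
  set T : ℕ → X → ℝ :=
    fun m x ↦ (∑ i ∈ Finset.range (N - m), ‖d (a + m + i) x‖ ^ 2) ^ (p / 2) with hTdef
  have hT0 : ∀ m x, 0 ≤ T m x := fun m x ↦
    Real.rpow_nonneg (Finset.sum_nonneg fun _ _ ↦ by positivity) _
  have hTm : ∀ m, Measurable (T m) := fun m ↦
    ((hd.adapted_sum_sq (a + m) (N - m)).comp (· ^ (p / 2))).measurable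
  have hρa : ∀ m : ℕ, L.Adapted (a + m) (ρ (m + 1)) := fun m ↦ L.adapted_maxExpect μ _ a m
  have hρa' : ∀ m : ℕ, L.Adapted (a + m) (ρ m) := fun m ↦ by
    cases m with
    | zero => exact fun I hI x hx y hy ↦ by simp only [hρ, lazyMaxPrev]
    | succ m => exact (hρa m).mono (by lia)
  -- The weight is constant on the atoms of generation a + m, precisely those at which the tail `T
  -- m` starts, so the testing condition applies to them.
  have hwa : ∀ m : ℕ, L.Adapted (a + m) (w m) := fun m ↦
    (hρa m).comp₂ (hρa' m) fun R r ↦ 8 * (R ^ p - r ^ p)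
  have hpt : ∀ x, (∑ j ∈ Finset.range N, ‖L.expect μ (a + j) f x * d (a + j) x‖ ^ 2) ^ (p / 2) ≤
      ∑ m ∈ Finset.range N, w m x * T m x := by
    intro x
    refine le_trans ?_ ((rpow_sum_lazyMax_le (hξ0 x) hp hp2 (D := fun j ↦ ‖d (a + j) x‖ ^ 2)
      (fun j ↦ by positivity) N).trans_eq ?_)
    · refine Real.rpow_le_rpow (Finset.sum_nonneg fun j _ ↦ by positivity) ?_ (by linarith)
      refine Finset.sum_le_sum fun j _ ↦ ?_
      rw [norm_mul, mul_pow]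
      gcongr
      exact L.norm_expect_le μ _ f x
    · refine Finset.sum_congr rfl fun m _ ↦ ?_
      simp only [hw, hρ, hTdef, Nat.cast_add, add_assoc]
  have hm : ∀ m, ∫⁻ x, ENNReal.ofReal (w m x) * ENNReal.ofReal (T m x) ∂ν ≤
      51 * (K * B ^ p) * ∫⁻ x, ENNReal.ofReal (w m x) ∂μ := by
    intro m
    refine ((hwa m).comp ENNReal.ofReal).lintegral_mul_le (hTm m).ennreal_ofReal fun J hJ ↦ ?_
    obtain ⟨s, hs, hsB⟩ := hT _ J hJ
    have hfin : ∫⁻ x in J, ‖s x‖ₑ ^ p ∂ν ≠ ∞ :=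
      ne_top_of_le_ne_top (ENNReal.mul_ne_top
        (ENNReal.rpow_ne_top_of_nonneg hp0.le ENNReal.coe_ne_top) (hμ _ J hJ).ne) hsB
    refine (setLIntegral_square_rpow_le hν hd hp hp2 hJ hs hfin (N - m)).trans ?_
    rw [mul_assoc, mul_assoc]
    gcongr
  have hf' : ∀ n, ∀ I ∈ L.atoms n, IntegrableOn (fun x ↦ ‖f x‖) I μ := fun n I hI ↦ (hf n I hI).norm
  calc _ ≤ ∫⁻ x, ∑ m ∈ Finset.range N, ENNReal.ofReal (w m x) * ENNReal.ofReal (T m x) ∂ν := by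
        refine lintegral_mono fun x ↦ ?_
        simp_rw [← ENNReal.ofReal_mul (hw0 _ _)]
        rw [← ENNReal.ofReal_sum_of_nonneg fun m _ ↦ mul_nonneg (hw0 m x) (hT0 m x)]
        exact ENNReal.ofReal_le_ofReal (hpt x)
    _ = ∑ m ∈ Finset.range N, ∫⁻ x, ENNReal.ofReal (w m x) * ENNReal.ofReal (T m x) ∂ν :=
        lintegral_finsetSum _ fun m _ ↦
          (hwa m).measurable.ennreal_ofReal.mul (hTm m).ennreal_ofReal
    _ ≤ ∑ m ∈ Finset.range N, 51 * (K * B ^ p) * ∫⁻ x, ENNReal.ofReal (w m x) ∂μ :=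
        Finset.sum_le_sum fun m _ ↦ hm m
    _ = 51 * (K * B ^ p) * ∫⁻ x, ENNReal.ofReal (∑ m ∈ Finset.range N, w m x) ∂μ := by
        rw [← Finset.mul_sum, ← lintegral_finsetSum _ fun m _ ↦ (hwa m).measurable.ennreal_ofReal]
        simp_rw [ENNReal.ofReal_sum_of_nonneg fun m _ ↦ hw0 m _]
    _ ≤ 51 * (K * B ^ p) * ∫⁻ x, 8 * ENNReal.ofReal (L.maxExpect μ (fun y ↦ ‖f y‖) a N x ^ p) ∂μ := by
        gcongr with x
        rw [← ENNReal.ofReal_ofNat, ← ENNReal.ofReal_mul (by norm_num)]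
        refine ENNReal.ofReal_le_ofReal ?_
        simp only [hw]
        -- The weights telescope to one power of the maximal function. In the end 408 = 51 * 8, and
        -- `K` is squared because Doob's inequality is used once for ν and once for μ.
        rw [← Finset.mul_sum, Finset.sum_range_sub fun m ↦ ρ m x ^ p]
        have h0 : ρ 0 x ^ p = 0 := by simp only [hρ, lazyMaxPrev, Real.zero_rpow hp0.ne']
        rw [h0, sub_zero]
        gcongr
        · exact lazyMaxPrev_nonneg (hξ0 x) N
        · cases N with
          | zero => exact lazyMax_nonneg (hξ0 x) 0
          | succ N => exact lazyMax_le_succ (hξ0 x) N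
    _ ≤ 51 * (K * B ^ p) * (8 * (K * ∫⁻ x, ENNReal.ofReal (‖f x‖ ^ p) ∂μ)) := by
        rw [lintegral_const_mul _
          ((L.adapted_maxExpect μ _ a N).comp (· ^ p)).measurable.ennreal_ofReal]
        gcongr
        exact L.lintegral_maxExpect_rpow_le hμ (fun _ ↦ norm_nonneg _) hf' hp a N
    _ = _ := by
        simp_rw [← ENNReal.ofReal_rpow_of_nonneg (norm_nonneg _) hp0.le, ofReal_norm]
        ring

end AtomicFiltration

/-! ### Convergence of the paraproduct: testing implies boundedness. -/

theorem ENNReal.ofReal_sum_norm_sq_rpow {ι 𝕜 : Type*} [RCLike 𝕜] (s : Finset ι) (f : ι → 𝕜)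
    {θ : ℝ} (hθ : 0 ≤ θ) :
    ENNReal.ofReal ((∑ i ∈ s, ‖f i‖ ^ 2) ^ θ) = (∑ i ∈ s, ‖f i‖ₑ ^ 2) ^ θ := by
  rw [← ENNReal.ofReal_rpow_of_nonneg (Finset.sum_nonneg fun _ _ ↦ by positivity) hθ,
    ENNReal.ofReal_sum_of_nonneg fun _ _ ↦ by positivity]
  simp_rw [ENNReal.ofReal_pow (norm_nonneg _), ofReal_norm]

theorem Finset.exists_subset_Ico_neg (F : Finset ℤ) : ∃ M : ℕ, F ⊆ Finset.Ico (-(M : ℤ)) M := by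
  refine ⟨F.sup Int.natAbs + 1, fun n hn ↦ ?_⟩
  have := Finset.le_sup (f := Int.natAbs) hn
  rw [Finset.mem_Ico]
  lia

theorem tendsto_Ico_neg_atTop :
    Tendsto (fun MN : ℕ × ℕ ↦ Finset.Ico (-(MN.1 : ℤ)) (MN.2 : ℤ)) atTop atTop := by
  refine tendsto_atTop.2 fun F ↦ ?_
  obtain ⟨M, hM⟩ := F.exists_subset_Ico_neg
  filter_upwards [eventually_ge_atTop (M, M)] with MN h
  have h1 := h.1
  have h2 := h.2
  simp only at h1 h2
  exact hM.trans (Finset.Ico_subset_Ico (by lia) (by lia))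

namespace AtomicFiltration

variable {X : Type*} [MeasurableSpace X] {𝕜 : Type*} [RCLike 𝕜] {L : AtomicFiltration X}
  {μ ν : Measure X} {d : ℤ → X → 𝕜}

theorem sum_range_indicator {Y A : Type*} [AddCommMonoid A] {F : Finset ℤ} {M : ℕ}
    (hM : F ⊆ Finset.Ico (-(M : ℤ)) M) (G : 𝕜 → A) (hG : G 0 = 0) (d : ℤ → Y → 𝕜) (x : Y) :
    ∑ j ∈ Finset.range (2 * M), G ((if -(M : ℤ) + j ∈ F then 1 else 0) * d (-(M : ℤ) + j) x) =
      ∑ n ∈ F, G (d n x) := by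
  have hM' : (M : ℤ) = -(M : ℤ) + (2 * M : ℕ) := by push_cast; ring
  rw [← sum_Ico_eq_sum_range (-(M : ℤ)) (2 * M) fun n ↦ G ((if n ∈ F then 1 else 0) * d n x),
    ← hM', ← Finset.sum_subset hM]
  · exact Finset.sum_congr rfl fun n hn ↦ by rw [if_pos hn, one_mul]
  · intro n _ hn
    rw [if_neg hn, zero_mul, hG]

theorem eLpNorm_ofReal_eq {p : ℝ} (hp0 : 0 < p) (ρ : Measure X) (f : X → 𝕜) :
    eLpNorm f (ENNReal.ofReal p) ρ = (∫⁻ x, ‖f x‖ₑ ^ p ∂ρ) ^ (1 / p) := by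
  rw [eLpNorm_eq_lintegral_rpow_enorm_toReal (by simpa using hp0) ENNReal.ofReal_ne_top,
    ENNReal.toReal_ofReal hp0.le]

theorem IsMartingaleDifference.measurable (hd : L.IsMartingaleDifference ν d) (n : ℤ) :
    Measurable (d n) :=
  (hd.adapted n).measurable

theorem IsMartingaleDifference.measurable_square (hd : L.IsMartingaleDifference ν d) (n : ℤ) :
    Measurable fun x ↦ ‖d n x‖ₑ ^ 2 :=
  ((hd.adapted n).comp (‖·‖ₑ ^ 2)).measurable

/-- Coefficients 0 and 1 select the generations in `F` from a long interval and preserve martingale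
differences. Arbitrary finite sets give unconditional convergence, so both ends of the series are
treated at once. -/
theorem IsMartingaleDifference.lintegral_finset_sum_rpow_le (hd : L.IsMartingaleDifference ν d)
    {p : ℝ} (hp : 1 < p) (hp2 : p ≤ 2) (F : Finset ℤ) :
    ∫⁻ x, ‖∑ n ∈ F, d n x‖ₑ ^ p ∂ν ≤ 28 * ∫⁻ x, (∑ n ∈ F, ‖d n x‖ₑ ^ 2) ^ (p / 2) ∂ν := by
  obtain ⟨M, hM⟩ := F.exists_subset_Ico_neg
  have hd' := hd.mul (a := fun n _ ↦ if n ∈ F then 1 else 0) fun n I hI x hx y hy ↦ rfl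
  have h := hd'.lintegral_rpow_le hp hp2 (-(M : ℤ)) (2 * M)
  simp_rw [ENNReal.ofReal_sum_norm_sq_rpow _ _ (show 0 ≤ p / 2 by linarith),
    ← ENNReal.ofReal_rpow_of_nonneg (norm_nonneg _) (show 0 ≤ p by linarith), ofReal_norm,
    sum_range_indicator hM (fun z : 𝕜 ↦ z) rfl,
    sum_range_indicator hM (fun z : 𝕜 ↦ ‖z‖ₑ ^ 2) (by simp)] at h
  exact h

/-- A martingale with square function in `L^p`, `1 < p ≤ 2`, converges unconditionally in `L^p`. -/
theorem IsMartingaleDifference.exists_tendsto (hd : L.IsMartingaleDifference ν d) {p : ℝ}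
    (hp : 1 < p) (hp2 : p ≤ 2) (hfin : ∫⁻ x, (∑' n, ‖d n x‖ₑ ^ 2) ^ (p / 2) ∂ν ≠ ∞) :
    ∃ g : X → 𝕜, MemLp g (ENNReal.ofReal p) ν ∧
      Tendsto (fun F : Finset ℤ ↦ eLpNorm ((fun x ↦ ∑ n ∈ F, d n x) - g) (ENNReal.ofReal p) ν)
        atTop (𝓝 0) := by
  have hp0 : 0 < p := by linarith
  have hq : (ENNReal.ofReal p) ≠ 0 := by simpa using hp0
  have hone : Fact (1 ≤ ENNReal.ofReal p) := ⟨by simpa using hp.le⟩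
  set P : Finset ℤ → X → 𝕜 := fun F x ↦ ∑ n ∈ F, d n x with hP
  have hPm : ∀ F, Measurable (P F) := fun F ↦
    Finset.measurable_sum F fun n _ ↦ hd.measurable n
  have hsq := hd.measurable_square
  have hnorm := eLpNorm_ofReal_eq (𝕜 := 𝕜) hp0 ν
  have hPL : ∀ F, MemLp (P F) (ENNReal.ofReal p) ν := by
    refine fun F ↦ ⟨(hPm F).aestronglyMeasurable, ?_⟩
    rw [hnorm]
    have hc : (28 : ℝ≥0∞) * ∫⁻ x, (∑' n, ‖d n x‖ₑ ^ 2) ^ (p / 2) ∂ν ≠ ∞ :=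
      ENNReal.mul_ne_top (by norm_num) hfin
    refine ENNReal.rpow_lt_top_of_nonneg (by positivity) (ne_top_of_le_ne_top hc
      ((hd.lintegral_finset_sum_rpow_le hp hp2 F).trans ?_))
    gcongr
    exact ENNReal.sum_le_tsum F
  -- By dominated convergence the square function outside `F` tends to zero in L^p. It dominates the
  -- difference of later partial sums, which are therefore Cauchy.
  have htail : Tendsto (fun F : Finset ℤ ↦
      ∫⁻ x, (∑' n : {n // n ∉ F}, ‖d n x‖ₑ ^ 2) ^ (p / 2) ∂ν) atTop (𝓝 0) := by
    have h := tendsto_lintegral_filter_of_dominated_convergence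
      (μ := ν) (l := (atTop : Filter (Finset ℤ))) (f := fun _ ↦ 0)
      (F := fun F x ↦ (∑' n : {n // n ∉ F}, ‖d n x‖ₑ ^ 2) ^ (p / 2))
      (fun x ↦ (∑' n, ‖d n x‖ₑ ^ 2) ^ (p / 2))
      (Eventually.of_forall fun F ↦
        (Measurable.tsum (f := fun (n : {n // n ∉ F}) x ↦ ‖d n x‖ₑ ^ 2) fun n ↦ hsq n).pow_const _)
      (Eventually.of_forall fun F ↦ Eventually.of_forall fun x ↦ by
        have := ENNReal.tsum_comp_le_tsum_of_injective
          (Subtype.val_injective (p := fun n ↦ n ∉ F)) fun n ↦ ‖d n x‖ₑ ^ 2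
        gcongr) hfin ?_
    · simpa using h
    · have hae := ae_lt_top ((Measurable.tsum hsq).pow_const (p / 2)) hfin
      filter_upwards [hae] with x hx
      have hx' : ∑' n, ‖d n x‖ₑ ^ 2 ≠ ∞ := fun h ↦ by
        rw [h, ENNReal.top_rpow_of_pos (by linarith)] at hx
        exact lt_irrefl _ hx
      have h1 := (ENNReal.tendsto_tsum_compl_atTop_zero hx').ennrpow_const (p / 2)
      rwa [ENNReal.zero_rpow_of_pos (by linarith)] at h1
  have hdiff : ∀ F₀ F : Finset ℤ, F₀ ⊆ F → eLpNorm (P F - P F₀) (ENNReal.ofReal p) ν ≤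
      (28 * ∫⁻ x, (∑' n : {n // n ∉ F₀}, ‖d n x‖ₑ ^ 2) ^ (p / 2) ∂ν) ^ (1 / p) := by
    intro F₀ F hF
    have : P F - P F₀ = P (F \ F₀) := by
      ext x
      simp only [hP, Pi.sub_apply]
      rw [← Finset.sum_sdiff hF, add_sub_cancel_right]
    rw [this, hnorm]
    refine ENNReal.rpow_le_rpow ((hd.lintegral_finset_sum_rpow_le hp hp2 _).trans ?_) (by positivity)
    gcongr with x
    have h1 : ∑ n ∈ F \ F₀, ‖d n x‖ₑ ^ 2 =
        ∑ n ∈ (F \ F₀).subtype (· ∉ F₀), ‖d n x‖ₑ ^ 2 := by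
      rw [Finset.sum_subtype_of_mem (fun n ↦ ‖d n x‖ₑ ^ 2)
        fun n hn ↦ (Finset.mem_sdiff.1 hn).2]
    rw [h1]
    exact ENNReal.sum_le_tsum _
  have hcauchy : CauchySeq fun F ↦ (hPL F).toLp (P F) := by
    rw [EMetric.cauchySeq_iff']
    intro ε hε
    have h1 : Tendsto (fun F₀ : Finset ℤ ↦
        (28 * ∫⁻ x, (∑' n : {n // n ∉ F₀}, ‖d n x‖ₑ ^ 2) ^ (p / 2) ∂ν) ^ (1 / p)) atTop (𝓝 0) := by
      have h2 := (ENNReal.Tendsto.const_mul (a := 28) htail (Or.inr (by norm_num))).ennrpow_const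
        (1 / p)
      rwa [mul_zero, ENNReal.zero_rpow_of_pos (by positivity)] at h2
    obtain ⟨F₀, hF₀⟩ := (h1.eventually (gt_mem_nhds hε)).exists
    refine ⟨F₀, fun F hF ↦ ?_⟩
    rw [Lp.edist_toLp_toLp]
    exact (hdiff F₀ F hF).trans_lt hF₀
  obtain ⟨G, hG⟩ := cauchySeq_tendsto_of_complete hcauchy
  refine ⟨G, Lp.memLp G, ?_⟩
  rw [tendsto_iff_edist_tendsto_0] at hG
  refine hG.congr fun F ↦ ?_
  rw [Lp.edist_def]
  exact eLpNorm_congr_ae ((hPL F).coeFn_toLp.sub EventuallyEq.rfl)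

/-- Fatou's lemma along the symmetric intervals of generations. -/
theorem lintegral_tsum_rpow_le {u : ℤ → X → ℝ≥0∞} (hu : ∀ n, Measurable (u n)) {θ : ℝ}
    {K : ℝ≥0∞} (h : ∀ M : ℕ, ∫⁻ x, (∑ n ∈ Finset.Ico (-(M : ℤ)) M, u n x) ^ θ ∂ν ≤ K) :
    ∫⁻ x, (∑' n, u n x) ^ θ ∂ν ≤ K := by
  have hdiag : Tendsto (fun M : ℕ ↦ Finset.Ico (-(M : ℤ)) (M : ℤ)) atTop atTop := by
    simpa only [Function.comp_def] using tendsto_Ico_neg_atTop.comp tendsto_atTop_diagonal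
  have hlim : ∀ x, Tendsto (fun M : ℕ ↦ (∑ n ∈ Finset.Ico (-(M : ℤ)) M, u n x) ^ θ)
      atTop (𝓝 ((∑' n, u n x) ^ θ)) := fun x ↦ by
    have h1 : HasSum (fun n ↦ u n x) (∑' n, u n x) := ENNReal.summable.hasSum
    exact (Tendsto.comp h1 hdiag).ennrpow_const θ
  calc ∫⁻ x, (∑' n, u n x) ^ θ ∂ν
      = ∫⁻ x, liminf (fun M : ℕ ↦ (∑ n ∈ Finset.Ico (-(M : ℤ)) M, u n x) ^ θ) atTop ∂ν :=
        lintegral_congr fun x ↦ (hlim x).liminf_eq.symm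
    _ ≤ liminf (fun M : ℕ ↦ ∫⁻ x, (∑ n ∈ Finset.Ico (-(M : ℤ)) M, u n x) ^ θ ∂ν) atTop :=
        lintegral_liminf_le fun M ↦ (Finset.measurable_sum _ fun n _ ↦ hu n).pow_const _
    _ ≤ liminf (fun _ : ℕ ↦ K) atTop := liminf_le_liminf (Eventually.of_forall h)
    _ = K := by simp

/-- The testing condition implies the boundedness of the paraproduct. -/
theorem Testing.paraBounded {p : ℝ} {B : ℝ≥0} (hT : L.Testing μ ν d p B)
    (hμ : L.LocallyFinite μ) (hν : L.LocallyFinite ν) (hd : L.IsMartingaleDifference ν d)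
    (hp : 1 < p) (hp2 : p ≤ 2) :
    L.ParaBounded μ ν d p
      ((28 * 408 * Real.toNNReal (2 ^ p / (p - 1)) ^ 2) ^ (1 / p) * B) := by
  intro f hf
  have hp0 : 0 < p := by linarith
  have hq : (ENNReal.ofReal p) ≠ 0 := by simpa using hp0
  have hfi : ∀ n, ∀ I ∈ L.atoms n, IntegrableOn f I μ := fun n I hI ↦ by
    have : IsFiniteMeasure (μ.restrict I) := isFiniteMeasure_restrict.2 (hμ n I hI).ne
    exact (hf.restrict I).integrable (by simpa using hp.le)
  have hd' := hd.mul fun n ↦ L.adapted_expect μ n f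
  set e : ℤ → X → 𝕜 := fun n x ↦ L.expect μ n f x * d n x with he
  set K : ℝ≥0∞ := 408 * ENNReal.ofReal (2 ^ p / (p - 1)) ^ 2 * B ^ p * ∫⁻ x, ‖f x‖ₑ ^ p ∂μ with hK
  have hffin : ∫⁻ x, ‖f x‖ₑ ^ p ∂μ ≠ ∞ := by
    have := hf.2
    rw [eLpNorm_lt_top_iff_lintegral_rpow_enorm_lt_top hq ENNReal.ofReal_ne_top,
      ENNReal.toReal_ofReal hp0.le] at this
    exact this.ne
  have hKfin : K ≠ ∞ := by
    refine ENNReal.mul_ne_top (ENNReal.mul_ne_top (ENNReal.mul_ne_top (by norm_num) ?_) ?_) hffin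
    · exact ENNReal.pow_ne_top ENNReal.ofReal_ne_top
    · exact ENNReal.rpow_ne_top_of_nonneg hp0.le ENNReal.coe_ne_top
  have hbd : ∀ M : ℕ,
      ∫⁻ x, (∑ n ∈ Finset.Ico (-(M : ℤ)) M, ‖e n x‖ₑ ^ 2) ^ (p / 2) ∂ν ≤ K := by
    intro M
    have hM' : (M : ℤ) = -(M : ℤ) + (2 * M : ℕ) := by push_cast; ring
    refine le_trans (le_of_eq ?_) (hT.lintegral_square_le hμ hν hd hp hp2 hfi (-(M : ℤ)) (2 * M))
    refine lintegral_congr fun x ↦ ?_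
    rw [ENNReal.ofReal_sum_norm_sq_rpow _ _ (by linarith),
      ← sum_Ico_eq_sum_range (-(M : ℤ)) (2 * M) fun n ↦ ‖e n x‖ₑ ^ 2, ← hM']
  have htot := lintegral_tsum_rpow_le (fun n ↦ hd'.measurable_square n) hbd
  obtain ⟨g, hg, hlim⟩ := hd'.exists_tendsto hp hp2 (ne_top_of_le_ne_top hKfin htot)
  have hpara : ∀ MN : ℕ × ℕ, L.paraPartial μ d f MN.1 MN.2 =
      fun x ↦ ∑ n ∈ Finset.Ico (-(MN.1 : ℤ)) (MN.2 : ℤ), e n x := fun MN ↦ rfl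
  refine ⟨g, ⟨hg, ?_⟩, ?_⟩
  · simp_rw [hpara]
    exact hlim.comp tendsto_Ico_neg_atTop
  · have hone : 1 ≤ ENNReal.ofReal p := by simpa using hp.le
    have hPm : ∀ F : Finset ℤ, Measurable fun x ↦ ∑ n ∈ F, e n x := fun F ↦
      Finset.measurable_sum F fun n _ ↦ hd'.measurable n
    -- Every partial sum obeys the bound uniformly in `F`, and the limit inherits it.
    have hle : ∀ F : Finset ℤ, eLpNorm g (ENNReal.ofReal p) ν ≤
        eLpNorm ((fun x ↦ ∑ n ∈ F, e n x) - g) (ENNReal.ofReal p) ν + (28 * K) ^ (1 / p) := by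
      intro F
      have h1 : g = (fun x ↦ ∑ n ∈ F, e n x) - ((fun x ↦ ∑ n ∈ F, e n x) - g) := by
        rw [sub_sub_cancel]
      nth_rewrite 1 [h1]
      refine (eLpNorm_sub_le (hPm F).aestronglyMeasurable
        ((hPm F).aestronglyMeasurable.sub hg.1) hone).trans ?_
      rw [add_comm]
      gcongr
      rw [eLpNorm_ofReal_eq hp0]
      refine ENNReal.rpow_le_rpow ((hd'.lintegral_finset_sum_rpow_le hp hp2 F).trans ?_)
        (by positivity)
      gcongr
      refine le_trans (lintegral_mono fun x ↦ ?_) htot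
      gcongr
      exact ENNReal.sum_le_tsum F
    have h2 : eLpNorm g (ENNReal.ofReal p) ν ≤ 0 + (28 * K) ^ (1 / p) :=
      ge_of_tendsto' (hlim.add_const _) hle
    rw [zero_add] at h2
    refine h2.trans_eq ?_
    have h1p : (0 : ℝ) ≤ 1 / p := by positivity
    rw [eLpNorm_ofReal_eq hp0 μ f, hK, ← mul_assoc, ENNReal.mul_rpow_of_nonneg _ _ h1p, ← mul_assoc,
      ENNReal.mul_rpow_of_nonneg _ _ h1p, ← ENNReal.rpow_mul, mul_one_div_cancel hp0.ne',
      ENNReal.rpow_one, ENNReal.coe_mul, ENNReal.coe_rpow_of_nonneg _ h1p]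
    congr 3
    rw [ENNReal.coe_mul, ENNReal.coe_mul, ENNReal.coe_pow, ENNReal.coe_ofNat, ENNReal.coe_ofNat,
      mul_assoc, ENNReal.ofReal]

end AtomicFiltration

/-! ### Boundedness implies testing. -/

/-- By Hölder's inequality the constant function equal to the mean has no larger L^p norm than `h`;
the triangle inequality gives the factor 2. -/
theorem eLpNorm_sub_average_le {X 𝕜 : Type*} [MeasurableSpace X] [RCLike 𝕜] {ρ : Measure X}
    [IsFiniteMeasure ρ] {p : ℝ} (hp : 1 ≤ p) {h : X → 𝕜} (hh : AEStronglyMeasurable h ρ) :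
    eLpNorm (fun x ↦ h x - ⨍ y, h y ∂ρ) (ENNReal.ofReal p) ρ ≤
      2 * eLpNorm h (ENNReal.ofReal p) ρ := by
  have hp0 : 0 < p := by linarith
  rcases eq_or_ne ρ 0 with rfl | h0
  · simp
  have hone : 1 ≤ ENNReal.ofReal p := by simpa using hp
  have hu0 : ρ Set.univ ≠ 0 := by simpa using h0
  have hut := measure_ne_top ρ Set.univ
  have h1 : ‖⨍ y, h y ∂ρ‖ₑ * ρ Set.univ ≤ eLpNorm h 1 ρ := by
    have e := measure_smul_average ρ h
    have e2 : ‖ρ.real Set.univ • ⨍ y, h y ∂ρ‖ₑ ≤ eLpNorm h 1 ρ := by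
      rw [e, eLpNorm_one_eq_lintegral_enorm]
      exact enorm_integral_le_lintegral_enorm h
    rwa [enorm_smul, Real.enorm_of_nonneg measureReal_nonneg, measureReal_def,
      ENNReal.ofReal_toReal hut, mul_comm] at e2
  have h2 := eLpNorm_le_eLpNorm_mul_rpow_measure_univ hone hh
  rw [ENNReal.toReal_one, ENNReal.toReal_ofReal hp0.le, div_one] at h2
  have h3 : ‖⨍ y, h y ∂ρ‖ₑ * ρ Set.univ ^ (1 / p) ≤ eLpNorm h (ENNReal.ofReal p) ρ := by
    have h4 := h1.trans h2
    have e1 : ρ Set.univ = ρ Set.univ ^ (1 / p) * ρ Set.univ ^ (1 - 1 / p) := by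
      rw [← ENNReal.rpow_add _ _ hu0 hut, add_sub_cancel, ENNReal.rpow_one]
    nth_rewrite 1 [e1] at h4
    rw [← mul_assoc] at h4
    exact (ENNReal.mul_le_mul_iff_left (ENNReal.rpow_pos (pos_iff_ne_zero.2 hu0) hut).ne'
      (ENNReal.rpow_ne_top_of_ne_zero hu0 hut)).1 h4
  calc _ ≤ eLpNorm h (ENNReal.ofReal p) ρ +
        eLpNorm (fun _ ↦ ⨍ y, h y ∂ρ) (ENNReal.ofReal p) ρ :=
        eLpNorm_sub_le hh aestronglyMeasurable_const hone
    _ ≤ eLpNorm h (ENNReal.ofReal p) ρ + eLpNorm h (ENNReal.ofReal p) ρ := by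
        rw [eLpNorm_const _ (by simpa using hp0) h0, ENNReal.toReal_ofReal hp0.le]
        gcongr
    _ = _ := (two_mul _).symm

namespace AtomicFiltration

variable {X : Type*} [MeasurableSpace X] {𝕜 : Type*} [RCLike 𝕜] {L : AtomicFiltration X}
  {μ ν : Measure X} {d : ℤ → X → 𝕜}

/-- An atom inside `J` of positive μ-measure has average 1. On an atom with μ I = 0 the average is 0
by convention, and there the assumption that the difference vanishes is what saves the identity. -/
theorem ae_restrict_expect_indicator_mul (hμ : L.LocallyFinite μ)
    (h0 : ∀ n, ∀ I ∈ L.atoms n, μ I = 0 → d n =ᵐ[ν.restrict I] 0) {k n : ℤ} (hkn : k ≤ n)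
    {J : Set X} (hJ : J ∈ L.atoms k) :
    ∀ᵐ x ∂ν.restrict J, L.expect μ n (J.indicator fun _ ↦ (1 : 𝕜)) x * d n x = d n x := by
  rw [ae_restrict_iff' (L.measurableSet_atom hJ)]
  refine L.ae_of_atoms (n := n) fun I hI ↦ ?_
  by_cases hμI : μ I = 0
  · filter_upwards [h0 n I hI hμI] with x hx _
    rw [hx, Pi.zero_apply, mul_zero]
  · refine ae_restrict_of_forall_mem (L.measurableSet_atom hI) fun x hxI hxJ ↦ ?_
    have hIJ := L.subset_of_mem_atoms hkn hI hJ hxI hxJ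
    rw [L.expect_eq μ hI hxI, setAverage_eq, setIntegral_congr_fun (g := fun _ ↦ (1 : 𝕜))
      (L.measurableSet_atom hI) fun y hy ↦ Set.indicator_of_mem (hIJ hy) _, ← setAverage_eq,
      setAverage_const hμI (hμ n I hI).ne, one_mul]

/-- On an atom `J` of generation `k`, a partial sum of the paraproduct of the indicator of `J` is,
up to a constant, the sum of the martingale differences of the generations from `k` on. -/
theorem exists_paraPartial_ae_eq (hd : L.IsMartingaleDifference ν d) (hμ : L.LocallyFinite μ)
    (h0 : ∀ n, ∀ I ∈ L.atoms n, μ I = 0 → d n =ᵐ[ν.restrict I] 0) {k : ℤ} {J : Set X}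
    (hJ : J ∈ L.atoms k) {M N : ℕ} (hM : -(M : ℤ) ≤ k) (hN : k ≤ N) :
    ∃ c : 𝕜, ∀ᵐ x ∂ν.restrict J, L.paraPartial μ d (J.indicator fun _ ↦ 1) M N x =
      c + ∑ n ∈ Finset.Ico k N, d n x := by
  obtain ⟨y, hy⟩ := L.nonempty_of_mem k J hJ
  set f : X → 𝕜 := J.indicator fun _ ↦ 1
  refine ⟨∑ n ∈ Finset.Ico (-(M : ℤ)) k, L.expect μ n f y * d n y, ?_⟩
  have hae : ∀ᵐ x ∂ν.restrict J, ∀ n : ℤ, k ≤ n → L.expect μ n f x * d n x = d n x := by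
    rw [ae_all_iff]
    intro n
    by_cases hn : k ≤ n
    · filter_upwards [ae_restrict_expect_indicator_mul hμ h0 hn hJ] with x hx _
      exact hx
    · exact Eventually.of_forall fun x h ↦ absurd h hn
  filter_upwards [hae, ae_restrict_mem (L.measurableSet_atom hJ)] with x hx hxJ
  rw [paraPartial, ← Finset.Ico_union_Ico_eq_Ico hM hN,
    Finset.sum_union (Finset.Ico_disjoint_Ico_consecutive _ _ _)]
  congr 1
  · refine Finset.sum_congr rfl fun n hn ↦ ?_
    have hn' := (Finset.mem_Ico.1 hn).2
    rw [((L.adapted_expect μ n f).mono hn'.le) J hJ x hxJ y hy,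
      ((hd.adapted n).mono (by lia)) J hJ x hxJ y hy]
  · exact Finset.sum_congr rfl fun n hn ↦ hx n (Finset.mem_Ico.1 hn).1

/-- The single `d n` need not be integrable on `J`, so the sum cannot be integrated term by term.
Instead the martingale property identifies the mean with the empty sum at time zero. -/
theorem average_sum_eq_zero (hν : L.LocallyFinite ν) (hd : L.IsMartingaleDifference ν d) {k : ℤ}
    {J : Set X} (hJ : J ∈ L.atoms k) {N : ℤ} (hN : k ≤ N)
    (hi : IntegrableOn (fun x ↦ ∑ n ∈ Finset.Ico k N, d n x) J ν) :
    ⨍ x in J, ∑ n ∈ Finset.Ico k N, d n x ∂ν = 0 := by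
  have hfin : IsFiniteMeasure (ν.restrict J) := isFiniteMeasure_restrict.2 (hν k J hJ).ne
  rcases eq_or_ne (ν.restrict J) 0 with h | h
  · rw [h, average_zero_measure]
  obtain ⟨M, rfl⟩ : ∃ M : ℕ, N = k + M := ⟨(N - k).toNat, by lia⟩
  have e : ∀ x, ∑ n ∈ Finset.Ico k (k + (M : ℤ)), d n x =
      ∑ j ∈ Finset.range M, if k ≤ k + (j : ℤ) then d (k + j) x else 0 := fun x ↦ by
    rw [sum_Ico_eq_sum_range k M fun n ↦ d n x]
    exact (sum_range_restrict k d x id M).symm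
  simp_rw [e] at hi ⊢
  have h1 := (hd.restrict hJ).sum_ae_eq_expect_sum hi (Nat.zero_le M)
  have : (ae (ν.restrict J)).NeBot := ae_neBot.2 h
  obtain ⟨x, hx, hxJ⟩ := (h1.and (ae_restrict_mem (L.measurableSet_atom hJ))).exists
  rw [Nat.cast_zero, add_zero, L.expect_eq _ hJ hxJ,
    Measure.restrict_restrict (L.measurableSet_atom hJ), Set.inter_self] at hx
  simpa using hx.symm

/-- The boundedness of the paraproduct implies the testing condition. -/
theorem ParaBounded.testing {p : ℝ} {A : ℝ≥0} (hA : L.ParaBounded μ ν d p A)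
    (hμ : L.LocallyFinite μ) (hν : L.LocallyFinite ν) (hd : L.IsMartingaleDifference ν d)
    (h0 : ∀ n, ∀ I ∈ L.atoms n, μ I = 0 → d n =ᵐ[ν.restrict I] 0) (hp : 1 < p) :
    L.Testing μ ν d p (2 * A) := by
  intro k J hJ
  have hp0 : 0 < p := by linarith
  have hone : 1 ≤ ENNReal.ofReal p := by simpa using hp.le
  have hJm := L.measurableSet_atom hJ
  have hfin : IsFiniteMeasure (ν.restrict J) := isFiniteMeasure_restrict.2 (hν k J hJ).ne
  set f : X → 𝕜 := J.indicator fun _ ↦ 1 with hf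
  have hfL : MemLp f (ENNReal.ofReal p) μ :=
    memLp_indicator_const _ hJm _ (Or.inr (hμ k J hJ).ne)
  obtain ⟨g, ⟨hg, hlim⟩, hgA⟩ := hA f hfL
  have hgJ : Integrable g (ν.restrict J) := (hg.restrict J).integrable hone
  have hPm : ∀ M N : ℕ, Measurable (L.paraPartial μ d f M N) := fun M N ↦
    Finset.measurable_sum _ fun n _ ↦ (hd.mul fun n ↦ L.adapted_expect μ n f).measurable n
  -- The paraproduct agrees with the local sum on `J` up to a constant, and the local sum has mean
  -- zero; this determines the constant.
  refine ⟨fun x ↦ g x - ⨍ y in J, g y ∂ν, ⟨hgJ.1.sub aestronglyMeasurable_const, ?_⟩, ?_⟩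
  · set C : ℝ≥0∞ := ν.restrict J Set.univ ^ (1 - 1 / p) with hC
    have hCfin : C ≠ ∞ := ENNReal.rpow_ne_top_of_nonneg
      (by rw [sub_nonneg, div_le_one hp0]; exact hp.le) (measure_ne_top _ _)
    set u : ℕ → ℝ≥0∞ := fun m ↦ eLpNorm (L.paraPartial μ d f m m - g) (ENNReal.ofReal p) ν with hu
    have hu0 : Tendsto u atTop (𝓝 0) := by
      simpa only [hu, Function.comp_def] using hlim.comp tendsto_atTop_diagonal
    have htoNat : Tendsto Int.toNat atTop atTop :=
      tendsto_atTop.2 fun b ↦ (eventually_ge_atTop (b : ℤ)).mono fun N hN ↦ by lia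
    have hbound : Tendsto (fun N : ℤ ↦ 2 * (u N.toNat * C)) atTop (𝓝 0) := by
      have h1 := ENNReal.Tendsto.const_mul (a := 2)
        (ENNReal.Tendsto.mul_const (b := C) (hu0.comp htoNat) (Or.inr hCfin))
        (Or.inr ENNReal.ofNat_ne_top)
      simpa using h1
    refine tendsto_of_tendsto_of_tendsto_of_le_of_le' tendsto_const_nhds hbound
      (Eventually.of_forall fun _ ↦ zero_le) ?_
    filter_upwards [eventually_ge_atTop k, eventually_ge_atTop (-k), eventually_ge_atTop 0,
      (hu0.comp htoNat).eventually (gt_mem_nhds ENNReal.zero_lt_top)] with N h1 h2 h3 h4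
    obtain ⟨m, rfl⟩ : ∃ m : ℕ, N = m := ⟨N.toNat, by lia⟩
    simp only [Function.comp, Int.toNat_natCast] at h4 ⊢
    obtain ⟨c, hc⟩ := exists_paraPartial_ae_eq hd hμ h0 hJ (M := m) (N := m) (by lia) h1
    set P := L.paraPartial μ d f m m with hP
    have hPg : MemLp (P - g) (ENNReal.ofReal p) ν :=
      ⟨(hPm m m).aestronglyMeasurable.sub hg.1, h4⟩
    have hPgJ : Integrable (P - g) (ν.restrict J) := (hPg.restrict J).integrable hone
    have hPJ : Integrable P (ν.restrict J) := by simpa using hPgJ.add hgJ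
    have hsum : ∀ᵐ x ∂ν.restrict J, P x - c = ∑ n ∈ Finset.Ico k (m : ℤ), d n x := by
      filter_upwards [hc] with x hx
      rw [hx, add_sub_cancel_left]
    have hFJ : IntegrableOn (fun x ↦ ∑ n ∈ Finset.Ico k (m : ℤ), d n x) J ν :=
      (hPJ.sub (integrable_const c)).congr hsum
    rcases eq_or_ne (ν.restrict J) 0 with hz | hz
    · rw [hz]
      simp
    have : NeZero (ν.restrict J) := ⟨hz⟩
    -- The constant from the earlier generations is the mean of `P`, so the error of the partial sum
    -- is `P - g` minus its own mean.
    have havg : ⨍ x in J, P x ∂ν = c := by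
      have e := average_sum_eq_zero hν hd hJ h1 hFJ
      rw [← average_congr hsum, average_eq,
        integral_sub hPJ (integrable_const c), smul_sub, ← average_eq, ← average_eq,
        average_const] at e
      exact sub_eq_zero.1 e
    have havg' : ⨍ x in J, (P - g) x ∂ν = c - ⨍ x in J, g x ∂ν := by
      rw [← havg, average_eq, average_eq, average_eq, ← smul_sub, ← integral_sub hPJ hgJ]
      rfl
    have hae : ((∑ n ∈ Finset.Ico k (m : ℤ), d n) - fun x ↦ g x - ⨍ y in J, g y ∂ν)
        =ᵐ[ν.restrict J] fun x ↦ (P - g) x - ⨍ y in J, (P - g) y ∂ν := by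
      filter_upwards [hc] with x hx
      rw [havg', Pi.sub_apply, Pi.sub_apply, Finset.sum_apply, hx]
      ring
    rw [eLpNorm_congr_ae hae]
    have h5 := eLpNorm_sub_average_le (p := 1) le_rfl hPgJ.1
    rw [ENNReal.ofReal_one] at h5
    refine h5.trans ?_
    have h6 := eLpNorm_le_eLpNorm_mul_rpow_measure_univ hone hPgJ.1
    rw [ENNReal.toReal_one, ENNReal.toReal_ofReal hp0.le, div_one] at h6
    have h7 : eLpNorm (P - g) (ENNReal.ofReal p) (ν.restrict J) ≤ u m :=
      eLpNorm_mono_measure _ Measure.restrict_le_self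
    gcongr
    exact h6.trans (mul_le_mul' h7 le_rfl)
  · have h1 : eLpNorm (fun x ↦ g x - ⨍ y in J, g y ∂ν) (ENNReal.ofReal p) (ν.restrict J) ≤
        2 * (A * μ J ^ (1 / p)) := by
      refine (eLpNorm_sub_average_le hp.le hgJ.1).trans ?_
      gcongr
      refine (eLpNorm_mono_measure _ Measure.restrict_le_self).trans (hgA.trans_eq ?_)
      rw [hf, eLpNorm_indicator_const hJm (by simpa using hp0) ENNReal.ofReal_ne_top,
        ENNReal.toReal_ofReal hp0.le, enorm_one, one_mul]
    rw [eLpNorm_ofReal_eq hp0] at h1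
    have h2 := ENNReal.rpow_le_rpow h1 hp0.le
    rw [← ENNReal.rpow_mul, one_div_mul_cancel hp0.ne', ENNReal.rpow_one, ← mul_assoc,
      ENNReal.mul_rpow_of_nonneg _ _ hp0.le, ← ENNReal.rpow_mul, one_div_mul_cancel hp0.ne',
      ENNReal.rpow_one] at h2
    rw [ENNReal.coe_mul, ENNReal.coe_ofNat]
    exact h2

end AtomicFiltration

theorem theorem1p1 (p : ℝ) (hp : 1 < p) (hp2 : p ≤ 2) :
    ∃ c C : ℝ≥0, 0 < c ∧ 0 < C ∧
      ∀ (X : Type*) [MeasurableSpace X] (𝕜 : Type*) [RCLike 𝕜] (L : AtomicFiltration X)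
        (μ ν : Measure X) (_ : L.LocallyFinite μ) (_ : L.LocallyFinite ν)
        (d : ℤ → X → 𝕜) (_ : L.IsMartingaleDifference ν d)
        (_ : ∀ n, ∀ I ∈ L.atoms n, μ I = 0 → d n =ᵐ[ν.restrict I] 0),
        ((∃ A : ℝ≥0, L.ParaBounded μ ν d p A) ↔ ∃ B : ℝ≥0, L.Testing μ ν d p B) ∧
        c * L.testConst μ ν d p ≤ L.paraConst μ ν d p ∧
        L.paraConst μ ν d p ≤ C * L.testConst μ ν d p := by
  have hp' : 0 < p - 1 := by linarith
  set C : ℝ≥0 := (28 * 408 * Real.toNNReal (2 ^ p / (p - 1)) ^ 2) ^ (1 / p) with hC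
  have hCpos : 0 < C := by
    have : 0 < Real.toNNReal (2 ^ p / (p - 1)) := Real.toNNReal_pos.2 (by positivity)
    exact NNReal.rpow_pos (by positivity)
  refine ⟨2⁻¹, C, by positivity, hCpos, ?_⟩
  intro X _ 𝕜 _ L μ ν hμ hν d hd h0
  refine ⟨⟨fun ⟨A, hA⟩ ↦ ⟨_, hA.testing hμ hν hd h0 hp⟩,
    fun ⟨B, hB⟩ ↦ ⟨_, hB.paraBounded hμ hν hd hp hp2⟩⟩, ?_, ?_⟩
  · refine le_iInf₂ fun A hA ↦ ?_
    have h1 : L.testConst μ ν d p ≤ ((2 * A : ℝ≥0) : ℝ≥0∞) :=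
      iInf₂_le _ (hA.testing hμ hν hd h0 hp)
    calc ((2⁻¹ : ℝ≥0) : ℝ≥0∞) * L.testConst μ ν d p ≤ ((2⁻¹ : ℝ≥0) : ℝ≥0∞) * (2 * A : ℝ≥0) := by
          gcongr
      _ = A := by
          rw [← ENNReal.coe_mul, inv_mul_cancel_left₀ two_ne_zero]
  -- Dividing by `C` leaves the bare infimum on the right, so each admissible `B` can be treated
  -- separately.
  · rw [← ENNReal.div_le_iff' (ENNReal.coe_ne_zero.2 hCpos.ne') ENNReal.coe_ne_top]
    refine le_iInf₂ fun B hB ↦ ?_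
    rw [ENNReal.div_le_iff' (ENNReal.coe_ne_zero.2 hCpos.ne') ENNReal.coe_ne_top,
      ← ENNReal.coe_mul]
    exact iInf₂_le _ (hB.paraBounded hμ hν hd hp hp2)
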